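/- Let $M$ be a compact connected smooth manifold (Hausdorff, without boundary) with $H_1(M;\mathbb Z)\cong\mathbb Z^b$ for some $b>0$, and let $\pi:\tilde M_a\to M$ be its universal Abelian cover, i.e. the connected covering space corresponding to the commutator subgroup of $\pi_1(M)$. Fix a basis $\Gamma_1,\dots,\Gamma_b$ of $H_1(M;\mathbb Z)$, smooth closed one-forms $\omega_1,\dots,\omega_b$ on $M$ with $\int_{\Gamma_j}\omega_i=\delta_{ij}$ (for instance harmonic ones), and a point $\tilde x_0\in\tilde M_a$, and let $\tilde\iota:\tilde M_a\to\mathbb R^b$ be given by $\tilde\iota_i(\tilde x)=\int_\gamma\pi^*\omega_i$, where $\gamma$ is any smooth path in $\tilde M_a$ from $\tilde x_0$ to $\tilde x$. A metric on $\tilde M_a$ is called equivariant if it induces the topology of $\tilde M_a$ and is invariant under all deck transformations, and proper if its closed balls are compact. For an integer matrix $A$ let $\Phi_A$ be the induced endomorphism of $\mathbb T^b=\mathbb R^b/\mathbb Z^b$. **1. Expanding case.** Let $f:M\to M$ be continuous, with lift $\tilde f:\tilde M_a\to\tilde M_a$, and let $A$ be the matrix of $f_*$ on $H_1(M;\mathbb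 Z)$ in the basis $\Gamma$. Assume that $f$ is $H_1$-expanding: all complex eigenvalues $\mu$ of $A$ satisfy $|\mu|>1$. Then the limit $\tilde\beta(\tilde x)=\lim_{n\to\infty}A^{-n}\,\tilde\iota(\tilde f^n(\tilde x))$ exists for every $\tilde x\in\tilde M_a$, $\tilde\beta$ is continuous and descends to a continuous map $\beta:M\to\mathbb T^b$ with $\beta\circ f=\Phi_A\circ\beta$, and the following are equivalent: - (a) $\beta$ is injective; - (b) $f$ is $\tilde M_a$-expanding: there are an equivariant metric $\tilde d$ on $\tilde M_a$ and a constant $\lambda>1$ with $\tilde d(\tilde f(\tilde x),\tilde f(\tilde y))\ge\lambda\,\tilde d(\tilde x,\tilde y)$ for all $\tilde x,\tilde y\in\tilde M_a$; - (c) for some (equivalently, for every) proper equivariant metric $\tilde d$ on $\tilde M_a$: if $\tilde x,\tilde x'\in\tilde M_a$ and there is a $K$ with $\tilde d(\tilde f^i(\tilde x),\tilde f^i(\tilde x'))<K$ for all integers $i\ge 0$, then $\tilde x=\tilde x'$. **2. Hyperbolic case.** Let $h:M\to M$ be a homeomorphism, with lift $\tilde h:\tilde M_a\to\tilde M_a$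 (a homeomorphism), and let $A$ be the matrix of $h_*$ on $H_1(M;\mathbb Z)$ in the basis $\Gamma$. Assume that $h$ is $H_1$-hyperbolic: no complex eigenvalue $\mu$ of $A$ satisfies $|\mu|=1$. Then for every $\tilde x\in\tilde M_a$ there is exactly one $\tilde\beta(\tilde x)\in\mathbb R^b$ for which $\|\tilde\iota(\tilde h^i(\tilde x))-A^i\tilde\beta(\tilde x)\|$ is bounded over $i\in\mathbb Z$, $\tilde\beta$ is continuous and descends to a continuous map $\beta:M\to\mathbb T^b$ with $\beta\circ h=\Phi_A\circ\beta$, and the following are equivalent: - (a) $\beta$ is injective; - (b) $h$ is $\tilde M_a$-hyperbolic: there are pseudo-metrics $\tilde d_1,\tilde d_2$ on $\tilde M_a$, invariant under all deck transformations, such that $\sqrt{\tilde d_1^2+\tilde d_2^2}$ is an equivariant metric, and a constant $\lambda>1$ with $\tilde d_1(\tilde h(\tilde x),\tilde h(\tilde y))\ge\lambda\,\tilde d_1(\tilde x,\tilde y)$ and $\tilde d_2(\tilde h^{-1}(\tilde x),\tilde h^{-1}(\tilde y))\ge\lambda\,\tilde d_2(\tilde x,\tilde y)$ for all $\tilde x,\tilde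 y\in\tilde M_a$; - (c) for some (equivalently, for every) proper equivariant metric $\tilde d$ on $\tilde M_a$: if $\tilde x,\tilde x'\in\tilde M_a$ and there is a $K$ with $\tilde d(\tilde h^i(\tilde x),\tilde h^i(\tilde x'))<K$ for all $i\in\mathbb Z$, then $\tilde x=\tilde x'$. -/

import Mathlib

open CategoryTheory AlgebraicTopology
open scoped Simplicial Manifold ContDiff Topology Matrix

universe u v

noncomputable section

namespace AbelianCover

/-! ### First integral homology -/

/-- The first singular homology group of `X` with integer coefficients. -/
abbrev H1 (X : Type u) [TopologicalSpace X] : ModuleCat.{u} ℤ :=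
  ((singularHomologyFunctor (ModuleCat.{u} ℤ) 1).obj (ModuleCat.of ℤ (ULift.{u} ℤ))).obj
    (TopCat.of X)

/-- The map on first homology induced by a continuous map. -/
def H1.map {X Y : Type u} [TopologicalSpace X] [TopologicalSpace Y] (f : C(X, Y)) :
    H1 X →ₗ[ℤ] H1 Y :=
  (((singularHomologyFunctor (ModuleCat.{u} ℤ) 1).obj (ModuleCat.of ℤ (ULift.{u} ℤ))).map
    (TopCat.ofHom f)).hom

/-- A path in `X`, seen as a singular `1`-simplex of `X`. -/
def singularSimplex {X : Type u} [TopologicalSpace X] {x y : X} (γ : Path x y) :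
    (TopCat.toSSet.obj (TopCat.of X)) _⦋1⦌ :=
  TopCat.toSSetObj₁Equiv.symm ((TopCat.pathEquiv (X := TopCat.of X) (x := x) (y := y)).symm γ).hom

/-- The singular `1`-chain of a closed path is a cycle. -/
theorem singularSimplex_d {X : Type u} [TopologicalSpace X] {x : X} (γ : Path x x) :
    (TopCat.toSSet.obj (TopCat.of X)).ιChainComplex
        (R := ModuleCat.of ℤ (ULift.{u} ℤ)) (singularSimplex γ) ≫
      ((TopCat.toSSet.obj (TopCat.of X)).chainComplex (ModuleCat.of ℤ (ULift.{u} ℤ))).d 1 0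
      = 0 := by
  have h := SSet.ιChainComplex_d (TopCat.toSSet.obj (TopCat.of X))
    (ModuleCat.of ℤ (ULift.{u} ℤ)) (singularSimplex γ)
  refine h.trans ?_
  rw [Fin.sum_univ_two]
  have e : (TopCat.toSSet.obj (TopCat.of X)).δ 0 (singularSimplex γ) =
      (TopCat.toSSet.obj (TopCat.of X)).δ 1 (singularSimplex γ) := by
    simp only [singularSimplex, TopCat.δ_zero_toSSetObj₁Equiv.symm,
      TopCat.δ_one_toSSetObj₁Equiv.symm]
    rw [TopCat.Path.hom₀, TopCat.Path.hom₁]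
  rw [e]
  simp

/-- The homology class of a closed path. -/
def loopClass {X : Type u} [TopologicalSpace X] {x : X} (γ : Path x x) : H1 X :=
  (((TopCat.toSSet.obj (TopCat.of X)).chainComplex (ModuleCat.of ℤ (ULift.{u} ℤ))).liftCycles
      ((TopCat.toSSet.obj (TopCat.of X)).ιChainComplex (singularSimplex γ)) 0 (by simp)
      (singularSimplex_d γ) ≫
    ((TopCat.toSSet.obj (TopCat.of X)).chainComplex
      (ModuleCat.of ℤ (ULift.{u} ℤ))).homologyπ 1).hom (ULift.up 1)

/-- The integer matrix of `f_*` on first homology in the basis `Γ`: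
`f_* (Γ j) = ∑ i, A i j • Γ i`. -/
def homologyMatrix {X : Type u} [TopologicalSpace X] {b : ℕ}
    (Γ : Module.Basis (Fin b) ℤ (H1 X)) (f : C(X, X)) : Matrix (Fin b) (Fin b) ℤ :=
  LinearMap.toMatrix Γ Γ (H1.map f)

/-- All complex eigenvalues lie outside the closed unit disc. -/
def IsExpandingMatrix {b : ℕ} (A : Matrix (Fin b) (Fin b) ℤ) : Prop :=
  ∀ μ : ℂ, Module.End.HasEigenvalue (Matrix.toLin' (A.map (fun k : ℤ => (k : ℂ)))) μ → 1 < ‖μ‖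

/-- No complex eigenvalue lies on the unit circle. -/
def IsHyperbolicMatrix {b : ℕ} (A : Matrix (Fin b) (Fin b) ℤ) : Prop :=
  ∀ μ : ℂ, Module.End.HasEigenvalue (Matrix.toLin' (A.map (fun k : ℤ => (k : ℂ)))) μ → ‖μ‖ ≠ 1

/-- The real matrix with the same entries. -/
def toRealMatrix {b : ℕ} (A : Matrix (Fin b) (Fin b) ℤ) : Matrix (Fin b) (Fin b) ℝ :=
  A.map (fun k : ℤ => (k : ℝ))

/-! ### The universal Abelian cover -/

/-- `p : N → M` is the universal Abelian cover of `M`: the connected covering space corresponding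
to the commutator subgroup of the fundamental group. -/
structure IsUniversalAbelianCover {N : Type v} {M : Type u} [TopologicalSpace N]
    [TopologicalSpace M] (p : C(N, M)) : Prop where
  connected : ConnectedSpace N
  covering : IsCoveringMap p
  surjective : Function.Surjective p
  range_map : ∀ y : N, (FundamentalGroup.map p y).range = commutator (FundamentalGroup M (p y))

/-- `d` is an equivariant metric on the total space of `p`: a metric which induces the given
topology and is invariant under all deck transformations. -/
structure IsEquivariantMetric {N : Type v} {M : Type u} [TopologicalSpace N]
    [TopologicalSpace M] (p : C(N, M)) (d : N → N → ℝ) : Prop where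
  eq_zero_iff : ∀ x y, d x y = 0 ↔ x = y
  symm : ∀ x y, d x y = d y x
  triangle : ∀ x y z, d x z ≤ d x y + d y z
  isOpen_iff : ∀ U : Set N, IsOpen U ↔ ∀ x ∈ U, ∃ ε > 0, {y | d x y < ε} ⊆ U
  equivariant : ∀ δ : N ≃ₜ N, (∀ x, p (δ x) = p x) → ∀ x y, d (δ x) (δ y) = d x y

/-- `d` is a pseudo-metric which is invariant under all deck transformations. -/
structure IsEquivariantPseudoMetric {N : Type v} {M : Type u} [TopologicalSpace N]
    [TopologicalSpace M] (p : C(N, M)) (d : N → N → ℝ) : Prop where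
  self : ∀ x, d x x = 0
  symm : ∀ x y, d x y = d y x
  triangle : ∀ x y z, d x z ≤ d x y + d y z
  equivariant : ∀ δ : N ≃ₜ N, (∀ x, p (δ x) = p x) → ∀ x y, d (δ x) (δ y) = d x y

/-- All closed balls are compact. -/
def IsProperMetric {N : Type v} [TopologicalSpace N] (d : N → N → ℝ) : Prop :=
  ∀ (x : N) (r : ℝ), IsCompact {y | d x y ≤ r}

/-- The lift `F` uniformly expands some equivariant metric on the cover. -/
def IsCoverExpanding {N : Type v} {M : Type u} [TopologicalSpace N]
    [TopologicalSpace M] (p : C(N, M)) (F : N → N) : Prop :=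
  ∃ d : N → N → ℝ, IsEquivariantMetric p d ∧
    ∃ lam : ℝ, 1 < lam ∧ ∀ x y, lam * d x y ≤ d (F x) (F y)

/-- The lift `H` is uniformly expanding for one, and `H⁻¹` for the other, of two equivariant
pseudo-metrics which together form an equivariant metric. -/
def IsCoverHyperbolic {N : Type v} {M : Type u} [TopologicalSpace N]
    [TopologicalSpace M] (p : C(N, M)) (H : N ≃ₜ N) : Prop :=
  ∃ d₁ d₂ : N → N → ℝ, IsEquivariantPseudoMetric p d₁ ∧ IsEquivariantPseudoMetric p d₂ ∧
    IsEquivariantMetric p (fun x y => Real.sqrt (d₁ x y ^ 2 + d₂ x y ^ 2)) ∧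
    ∃ lam : ℝ, 1 < lam ∧ (∀ x y, lam * d₁ x y ≤ d₁ (H x) (H y)) ∧
      ∀ x y, lam * d₂ x y ≤ d₂ (H.symm x) (H.symm y)

/-- Distinct points have `F`-orbits which do not stay a bounded `d`-distance apart. -/
def NoShadowing {N : Type v} (d : N → N → ℝ) (F : N → N) : Prop :=
  ∀ x x' : N, (∃ K : ℝ, ∀ i : ℕ, d (F^[i] x) (F^[i] x') < K) → x = x'

/-- Distinct points have two-sided `H`-orbits which do not stay a bounded `d`-distance apart. -/
def NoTwoSidedShadowing {N : Type v} [TopologicalSpace N] (d : N → N → ℝ) (H : N ≃ₜ N) : Prop :=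
  ∀ x x' : N, (∃ K : ℝ, ∀ i : ℤ, d ((H ^ i) x) ((H ^ i) x') < K) → x = x'

/-! ### Closed one-forms and the Abel-Jacobi map -/

section Forms

variable {n : ℕ} {M : Type u} [TopologicalSpace M] [ChartedSpace (EuclideanSpace ℝ (Fin n)) M]

/-- A field of covectors on `M`. -/
abbrev CovectorField (n : ℕ) (M : Type u) [TopologicalSpace M]
    [ChartedSpace (EuclideanSpace ℝ (Fin n)) M] : Type u :=
  (x : M) → TangentSpace (𝓡 n) x →L[ℝ] ℝ

/-- The pull-back of `η` under the inverse of the chart at `x`. -/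
def localForm (η : CovectorField n M) (x : M) (y : EuclideanSpace ℝ (Fin n)) :
    EuclideanSpace ℝ (Fin n) →L[ℝ] ℝ :=
  (η ((extChartAt (𝓡 n) x).symm y)).comp
    (mfderiv 𝓘(ℝ, EuclideanSpace ℝ (Fin n)) (𝓡 n) (extChartAt (𝓡 n) x).symm y)

/-- `η` is a smooth one-form with `dη = 0`; in a chart, `dη (v, w) = Dη v w - Dη w v`. -/
structure IsClosedOneForm (η : CovectorField n M) : Prop where
  smooth : ∀ x : M, ContDiffOn ℝ ∞ (localForm η x) (extChartAt (𝓡 n) x).target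
  closed : ∀ x : M, ∀ y ∈ (extChartAt (𝓡 n) x).target, ∀ v w : EuclideanSpace ℝ (Fin n),
    fderiv ℝ (localForm η x) y v w = fderiv ℝ (localForm η x) y w v

/-- The path is `C^∞` on `[0, 1]`. -/
def IsSmoothPath {x y : M} (γ : Path x y) : Prop :=
  ContMDiffOn 𝓘(ℝ, ℝ) (𝓡 n) ∞ γ.extend (Set.Icc 0 1)

/-- The integral of `η` along `γ`. -/
def lineIntegral (η : CovectorField n M) {x y : M} (γ : Path x y) : ℝ :=
  ∫ t in (0 : ℝ)..1, η (γ.extend t)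
    (mfderivWithin 𝓘(ℝ, ℝ) (𝓡 n) γ.extend (Set.Icc 0 1) t (1 : ℝ))

/-- The closed one-forms `η i` are dual to the homology basis `Γ`: the integral of `η i` over
a closed curve representing `Γ j` is the Kronecker delta. -/
structure IsDualFamily {b : ℕ} (Γ : Module.Basis (Fin b) ℤ (H1 M))
    (η : Fin b → CovectorField n M) : Prop where
  closed : ∀ i, IsClosedOneForm (η i)
  dual : ∀ (i j : Fin b) (x : M) (γ : Path x x), IsSmoothPath (n := n) γ → loopClass γ = Γ j →
    lineIntegral (η i) γ = if i = j then 1 else 0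

open Classical in
/-- The map `N → ℝ^b` obtained by integrating the lifts of the forms `η i` along a smooth path
from `x₀` to `x` (a path in the cover is smooth when its projection is). -/
def abelJacobi {N : Type v} [TopologicalSpace N] {b : ℕ} (p : C(N, M))
    (η : Fin b → CovectorField n M) (x₀ x : N) : Fin b → ℝ := fun i =>
  if h : ∃ γ : Path x₀ x, IsSmoothPath (n := n) (γ.map p.continuous) then
    lineIntegral (η i) (h.choose.map p.continuous)
  else 0

end Forms

/-! ### The torus -/

/-- The torus `ℝ^b / ℤ^b`. -/
abbrev Torus (b : ℕ) : Type := Fin b → UnitAddCircle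

/-- The endomorphism of the torus induced by an integer matrix. -/
def toralEndomorphism {b : ℕ} (A : Matrix (Fin b) (Fin b) ℤ) (y : Torus b) : Torus b :=
  fun i => ∑ j, A i j • y j

end AbelianCover

end

/-!
The integrals of the dual forms give a period map `j : N → ℝ^b`: two points of a fibre of `p` are
mapped to points differing by an integer vector, every integer translation of a fibre is realised
by exactly one deck transformation, and a lift `F` of `f` satisfies `j ∘ F = A j` along fibres.
Hence `j ∘ F - A j` descends to a continuous function `g` on the compact base, and adding to `j` the
solution `φ` of `A φ = φ ∘ f + g` turns it into an exact semiconjugacy `β̃ = j + φ ∘ p`. For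
expanding or hyperbolic `A` the equation is solved by a geometric series in the two spectral
subspaces of `A`, and `A` expands, respectively contracts, a pair of adapted seminorms.

As `β̃` is again a period map, it is proper and controls every equivariant metric: points with
close `β̃`-values are uniformly close, and the converse holds when the metric is proper. Two orbits
thus stay at bounded distance exactly when their `β̃`-orbits do, which by expansiveness of `A` means
that they start at points with the same `β̃`-value. If `β̃` is injective, pulling back the adapted
seminorms gives the expanding metric or the hyperbolic pair of pseudo-metrics; conversely, points
with the same `β̃`-value have orbits at bounded distance, so expansion forces them to coincide.
-/

noncomputable section

namespace AbelianCover

/-! ### Cocycles on paths -/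

/-- The straight path between two vertices of a standard simplex. -/
def simplexEdge {ι : Type*} [Fintype ι] [DecidableEq ι] (i j : ι) :
    Path (stdSimplex.vertex i : stdSimplex ℝ ι) (stdSimplex.vertex j) where
  toFun t := stdSimplex.map ![i, j] (stdSimplexHomeomorphUnitInterval.symm t)
  continuous_toFun := (stdSimplex.continuous_map _).comp
    stdSimplexHomeomorphUnitInterval.symm.continuous
  source' := by
    rw [← stdSimplexHomeomorphUnitInterval_zero, Homeomorph.symm_apply_apply]
    exact stdSimplex.map_vertex ![i, j] 0
  target' := by
    rw [← stdSimplexHomeomorphUnitInterval_one, Homeomorph.symm_apply_apply]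
    exact stdSimplex.map_vertex ![i, j] 1

theorem map_stdSimplexHomeomorphUnitInterval_symm {ι : Type*} [Fintype ι] [DecidableEq ι]
    (f : Fin 2 → ι) (t : unitInterval) :
    stdSimplex.map f (stdSimplexHomeomorphUnitInterval.symm t) = simplexEdge (f 0) (f 1) t := by
  have hf : f = ![f 0, f 1] := by
    ext i
    fin_cases i <;> rfl
  exact congr_arg (stdSimplex.map · _) hf

theorem simplexEdge_apply {ι : Type*} [Fintype ι] [DecidableEq ι] (i j : ι) (t : unitInterval)
    (k : ι) :
    simplexEdge i j t k = (if i = k then 1 - (t : ℝ) else 0) + if j = k then (t : ℝ) else 0 := by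
  change stdSimplex.map ![i, j] (stdSimplexHomeomorphUnitInterval.symm t) k = _
  rw [stdSimplex.map_coe, FunOnFinite.linearMap_apply_apply, Finset.sum_filter, Fin.sum_univ_two]
  rfl

instance contractibleSpace_stdSimplex {ι : Type*} [Fintype ι] [Nonempty ι] :
    ContractibleSpace (stdSimplex ℝ ι) := by
  classical
  exact (convex_stdSimplex ℝ ι).contractibleSpace
    ⟨_, (stdSimplex.vertex (Classical.arbitrary ι)).2⟩

/-- An `A`-valued cocycle on the fundamental groupoid of `X`: a functional on homotopy classes of
paths which is additive under concatenation. The class of a path in the singular chains modulo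
boundaries and the integral of a closed form are the examples of interest. -/
structure PathCocycle (X : Type*) [TopologicalSpace X] (A : Type*) [AddCommGroup A] where
  along {x y : X} : Path.Homotopic.Quotient x y → A
  along_trans {x y z : X} (γ : Path.Homotopic.Quotient x y) (γ' : Path.Homotopic.Quotient y z) :
    along (γ.trans γ') = along γ + along γ'

namespace PathCocycle

variable {X : Type*} [TopologicalSpace X] {A : Type*} [AddCommGroup A] (c : PathCocycle X A)

/-- The restriction of a cocycle to the loops at `x`. -/
def toMonoidHom (x : X) : FundamentalGroup X x →* Multiplicative A :=
  MonoidHom.mk' (fun γ => Multiplicative.ofAdd (c.along γ)) fun γ γ' => by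
    rw [← ofAdd_add, add_comm, ← c.along_trans]
    rfl

theorem along_refl (x : X) : c.along (.mk (Path.refl x)) = 0 :=
  congr_arg Multiplicative.toAdd (c.toMonoidHom x).map_one

theorem along_symm {x y : X} (γ : Path x y) : c.along (.mk γ.symm) = -c.along (.mk γ) := by
  rw [eq_neg_iff_add_eq_zero, add_comm, ← c.along_trans, ← Path.Homotopic.Quotient.mk_trans,
    ← c.along_refl x]
  exact congr_arg _ (Path.Homotopic.Quotient.eq.2 ⟨(Path.Homotopy.reflTransSymm γ).symm⟩)

theorem along_congr {x y x' y' : X} {γ : Path x y} {γ' : Path x' y'} (h : ∀ t, γ t = γ' t) :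
    c.along (.mk γ) = c.along (.mk γ') := by
  obtain rfl : x = x' := by simpa using h 0
  obtain rfl : y = y' := by simpa using h 1
  rw [Path.ext (funext h)]

theorem along_triangle (τ : C(stdSimplex ℝ (Fin 3), X)) {x₀ x₁ x₂ y₀ y₁ y₂ : X}
    {p₀₁ : Path x₀ x₁} {p₁₂ : Path y₁ x₂} {p₀₂ : Path y₀ y₂}
    (h₀₁ : ∀ t, p₀₁ t = τ (simplexEdge 0 1 t)) (h₁₂ : ∀ t, p₁₂ t = τ (simplexEdge 1 2 t))
    (h₀₂ : ∀ t, p₀₂ t = τ (simplexEdge 0 2 t)) :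
    c.along (.mk p₀₂) = c.along (.mk p₀₁) + c.along (.mk p₁₂) := by
  have homotopic : ((simplexEdge 0 2).map τ.continuous).Homotopic
      (((simplexEdge 0 1).map τ.continuous).trans ((simplexEdge 1 2).map τ.continuous)) := by
    rw [← Path.map_trans]
    exact (SimplyConnectedSpace.paths_homotopic _ _).map τ
  rw [c.along_congr (γ' := (simplexEdge 0 2).map τ.continuous) h₀₂,
    c.along_congr (γ' := (simplexEdge 0 1).map τ.continuous) h₀₁,
    c.along_congr (γ' := (simplexEdge 1 2).map τ.continuous) h₁₂,
    Path.Homotopic.Quotient.eq.2 homotopic, Path.Homotopic.Quotient.mk_trans, c.along_trans]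

theorem along_eq_zero_of_mem_commutator {x : X} {γ : FundamentalGroup X x}
    (h : γ ∈ commutator (FundamentalGroup X x)) : c.along γ = 0 :=
  Multiplicative.ofAdd.injective
    (MonoidHom.mem_ker.1 (Abelianization.commutator_subset_ker (c.toMonoidHom x) h))

theorem along_map_eq {Y : Type*} [TopologicalSpace Y] {p : C(Y, X)} {x y : Y}
    (hp : (FundamentalGroup.map p x).range ≤ commutator (FundamentalGroup X (p x)))
    (γ γ' : Path x y) :
    c.along (.mk (γ.map p.continuous)) = c.along (.mk (γ'.map p.continuous)) := by
  have loop_eq_zero : c.along (.mk ((γ.trans γ'.symm).map p.continuous)) = 0 :=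
    c.along_eq_zero_of_mem_commutator
      (hp ⟨FundamentalGroup.fromPath (.mk (γ.trans γ'.symm)), rfl⟩)
  rwa [Path.map_trans, Path.Homotopic.Quotient.mk_trans, c.along_trans, ← Path.map_symm,
    c.along_symm, add_neg_eq_zero] at loop_eq_zero

end PathCocycle

/-! ### Singular chains in degree one -/

section SingularChains

variable {X : Type u} [TopologicalSpace X]

variable (X) in
/-- The singular `k`-simplices of `X`. -/
abbrev SingularSimplex (k : ℕ) : Type u := (TopCat.toSSet.obj (TopCat.of X)) _⦋k⦌

/-- The map on the standard simplex underlying a singular simplex. -/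
abbrev SingularSimplex.toMap {k : ℕ} (s : SingularSimplex X k) : C(stdSimplex ℝ (Fin (k + 1)), X) :=
  (TopCat.of X).toSSetObjEquiv _ s

/-- The `i`-th face of a singular simplex. -/
abbrev SingularSimplex.face {k : ℕ} (i : Fin (k + 2)) (s : SingularSimplex X (k + 1)) :
    SingularSimplex X k :=
  (TopCat.toSSet.obj (TopCat.of X)).δ i s

/-- The coefficient module of the singular chains; it is lifted to the universe of the space. -/
abbrev coeffs : ModuleCat.{u} ℤ := ModuleCat.of ℤ (ULift.{u} ℤ)

variable (X) in
/-- The integral singular chain complex of `X`. -/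
abbrev chains : ChainComplex (ModuleCat.{u} ℤ) ℕ :=
  (TopCat.toSSet.obj (TopCat.of X)).chainComplex coeffs

/-- A singular simplex, as a chain. -/
def basisChain {k : ℕ} (s : SingularSimplex X k) : (chains X).X k :=
  ((TopCat.toSSet.obj (TopCat.of X)).ιChainComplex (R := coeffs) s).hom (ULift.up 1)

theorem chains_linearMap_ext {k : ℕ} {V : Type u} [AddCommGroup V] [Module ℤ V]
    {f g : (chains X).X k →ₗ[ℤ] V} (h : ∀ s, f (basisChain s) = g (basisChain s)) : f = g := by
  suffices ModuleCat.ofHom f = ModuleCat.ofHom g from congr_arg ModuleCat.Hom.hom this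
  refine SSet.chainComplex_hom_ext fun s => ModuleCat.hom_ext (LinearMap.ext fun n => ?_)
  obtain ⟨m, rfl⟩ : ∃ m : ℤ, n = m • (ULift.up 1 : coeffs.{u}) :=
    ⟨n.down, ULift.ext _ _ (by simp)⟩
  rw [map_zsmul, map_zsmul]
  exact congr_arg (m • ·) (h s)

theorem span_range_basisChain {k : ℕ} :
    Submodule.span ℤ (Set.range (basisChain (X := X) (k := k))) = ⊤ := by
  let S := Submodule.span ℤ (Set.range (basisChain (X := X) (k := k)))
  let _ : Module ℤ ((chains X).X k ⧸ S) := Submodule.Quotient.module S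
  have mkQ_eq_zero : S.mkQ = 0 := chains_linearMap_ext fun s =>
    (Submodule.Quotient.mk_eq_zero S).2 (Submodule.subset_span ⟨s, rfl⟩)
  exact (Submodule.ker_mkQ S).symm.trans ((congr_arg LinearMap.ker mkQ_eq_zero).trans
    LinearMap.ker_zero)

theorem exists_chains_linearMap {k : ℕ} {V : Type u} [AddCommGroup V] [Module ℤ V]
    (g : SingularSimplex X k → V) :
    ∃ φ : (chains X).X k →ₗ[ℤ] V, ∀ s, φ (basisChain s) = g s := by
  let onSimplex (s : SingularSimplex X k) : coeffs ⟶ ModuleCat.of ℤ V :=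
    ModuleCat.ofHom ((LinearMap.toSpanSingleton ℤ V (g s)).comp ULift.moduleEquiv.toLinearMap)
  let isColimit := (TopCat.toSSet.obj (TopCat.of X)).isColimitChainComplexXCofan coeffs k
  refine ⟨(Limits.Cofan.IsColimit.desc isColimit onSimplex).hom, fun s => ?_⟩
  refine congr(($(Limits.Cofan.IsColimit.fac isColimit onSimplex s)).hom (ULift.up 1)).trans ?_
  simp only [onSimplex, ModuleCat.hom_ofHom]
  exact (ModuleCat.of ℤ V).isModule.one_smul (g s)

theorem d_basisChain {k : ℕ} (s : SingularSimplex X (k + 1)) :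
    ((chains X).d (k + 1) k).hom (basisChain s) =
      ∑ i : Fin (k + 2), (-1 : ℤ) ^ (i : ℕ) • basisChain (s.face i) := by
  refine congr(($(SSet.ιChainComplex_d (TopCat.toSSet.obj (TopCat.of X)) coeffs s)).hom
    (ULift.up 1)).trans ?_
  simp only [ModuleCat.hom_sum, LinearMap.sum_apply, ModuleCat.hom_zsmul]
  rfl

end SingularChains

section Hurewicz

variable {X : Type u} [TopologicalSpace X]

/-- The class of a singular `1`-simplex in the chains modulo boundaries. -/
def simplexClass (s : SingularSimplex X 1) : (chains X).opcycles 1 :=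
  ((chains X).pOpcycles 1).hom (basisChain s)

/-- The class of a path in the singular `1`-chains modulo boundaries. -/
def edgeClass {x y : X} (γ : Path x y) : (chains X).opcycles 1 :=
  simplexClass (singularSimplex γ)

theorem simplexClass_face_one (s : SingularSimplex X 2) :
    simplexClass (s.face 1) = simplexClass (s.face 2) + simplexClass (s.face 0) := by
  have boundary_eq_zero := congr(($((chains X).d_pOpcycles 2 1)).hom (basisChain s))
  rw [ModuleCat.hom_comp, LinearMap.comp_apply, d_basisChain, map_sum, Fin.sum_univ_three]
    at boundary_eq_zero
  simp only [map_zsmul, Fin.val_zero, Fin.val_one, Fin.val_two, pow_zero, pow_one, one_smul,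
    even_two, Even.neg_pow, one_pow] at boundary_eq_zero
  rw [eq_comm, ← sub_eq_zero]
  refine Eq.trans ?_ boundary_eq_zero
  simp only [simplexClass]
  abel

theorem toMap_singularSimplex {x y : X} (γ : Path x y) (t : unitInterval) :
    SingularSimplex.toMap (singularSimplex γ) (stdSimplexHomeomorphUnitInterval.symm t) = γ t :=
  congr_arg γ (Homeomorph.apply_symm_apply _ t)

theorem eq_singularSimplex {x y : X} {γ : Path x y} {s : SingularSimplex X 1}
    (h : ∀ t, s.toMap (stdSimplexHomeomorphUnitInterval.symm t) = γ t) :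
    s = singularSimplex γ := by
  apply ((TopCat.of X).toSSetObjEquiv _).injective
  ext z
  obtain ⟨t, rfl⟩ := stdSimplexHomeomorphUnitInterval.symm.surjective z
  exact (h t).trans (toMap_singularSimplex γ t).symm

theorem SingularSimplex.toMap_face (s : SingularSimplex X 2) (i : Fin 3) (t : unitInterval) :
    (s.face i).toMap (stdSimplexHomeomorphUnitInterval.symm t) =
      s.toMap (simplexEdge (i.succAbove 0) (i.succAbove 1) t) :=
  congr_arg s.toMap (map_stdSimplexHomeomorphUnitInterval_symm i.succAbove t)

theorem edgeClass_triangle (τ : C(stdSimplex ℝ (Fin 3), X)) {x y z : X} {p₀₁ : Path x y}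
    {p₁₂ : Path y z} {p₀₂ : Path x z} (h₀₁ : ∀ t, τ (simplexEdge 0 1 t) = p₀₁ t)
    (h₁₂ : ∀ t, τ (simplexEdge 1 2 t) = p₁₂ t) (h₀₂ : ∀ t, τ (simplexEdge 0 2 t) = p₀₂ t) :
    edgeClass p₀₂ = edgeClass p₀₁ + edgeClass p₁₂ := by
  let s : SingularSimplex X 2 := ((TopCat.of X).toSSetObjEquiv _).symm τ
  have faces := simplexClass_face_one s
  rwa [eq_singularSimplex (s := s.face 0) fun t => (s.toMap_face 0 t).trans (h₁₂ t),
    eq_singularSimplex (s := s.face 1) fun t => (s.toMap_face 1 t).trans (h₀₂ t),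
    eq_singularSimplex (s := s.face 2) fun t => (s.toMap_face 2 t).trans (h₀₁ t)] at faces

theorem continuous_stdSimplex_apply {ι : Type*} [Fintype ι] (i : ι) :
    Continuous fun z : stdSimplex ℝ ι => z i :=
  (continuous_apply i).comp continuous_subtype_val

theorem edgeClass_trans {x y z : X} (γ : Path x y) (γ' : Path y z) :
    edgeClass (γ.trans γ') = edgeClass γ + edgeClass γ' := by
  refine edgeClass_triangle ⟨fun w => (γ.trans γ').extend (w 1 / 2 + w 2),
    (γ.trans γ').continuous_extend.comp
      (((continuous_stdSimplex_apply 1).div_const 2).add (continuous_stdSimplex_apply 2))⟩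
    (fun t => ?_) (fun t => ?_) fun t => ?_
  · simp only [ContinuousMap.coe_mk, simplexEdge_apply, Fin.reduceEq, if_true, if_false, zero_add,
      add_zero]
    rw [Path.extend_trans_of_le_half _ _ (by linarith [t.2.2]), mul_div_cancel₀ _ two_ne_zero,
      Path.extend_apply]
  · simp only [ContinuousMap.coe_mk, simplexEdge_apply, Fin.reduceEq, if_true, if_false, zero_add,
      add_zero]
    rw [Path.extend_trans_of_half_le _ _ (by linarith [t.2.1]),
      show 2 * ((1 - (t : ℝ)) / 2 + t) - 1 = t by ring, Path.extend_apply]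
  · simp [simplexEdge_apply]

theorem edgeClass_refl (x : X) : edgeClass (Path.refl x) = 0 := by
  have degenerate := edgeClass_triangle (ContinuousMap.const _ x) (p₀₁ := Path.refl x)
    (p₁₂ := Path.refl x) (p₀₂ := Path.refl x) (fun _ => rfl) (fun _ => rfl) fun _ => rfl
  simpa using degenerate

theorem edgeClass_eq_of_homotopic {x y : X} {γ γ' : Path x y} (h : γ.Homotopic γ') :
    edgeClass γ = edgeClass γ' := by
  obtain ⟨F⟩ := h
  have c₁ := continuous_stdSimplex_apply (1 : Fin 3)
  have c₂ := continuous_stdSimplex_apply (2 : Fin 3)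
  let diagonal : Path x y :=
    { toFun t := F (t, t)
      continuous_toFun := by fun_prop
      source' := by simp
      target' := by simp }
  let r : ℝ → unitInterval := Set.projIcc 0 1 zero_le_one
  have hr : Continuous r := continuous_projIcc
  have lower : edgeClass diagonal = edgeClass γ + edgeClass (Path.refl y) := by
    refine edgeClass_triangle ⟨fun w => F (r (w 2), r (w 1 + w 2)),
      F.continuous.comp ((hr.comp c₂).prodMk (hr.comp (c₁.add c₂)))⟩ ?_ ?_ ?_ <;>
      simp [simplexEdge_apply, r, diagonal]
  have upper : edgeClass diagonal = edgeClass (Path.refl x) + edgeClass γ' := by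
    refine edgeClass_triangle ⟨fun w => F (r (w 1 + w 2), r (w 2)),
      F.continuous.comp ((hr.comp (c₁.add c₂)).prodMk (hr.comp c₂))⟩ ?_ ?_ ?_ <;>
      simp [simplexEdge_apply, r, diagonal]
  rw [edgeClass_refl, add_zero] at lower
  rw [edgeClass_refl, zero_add] at upper
  exact lower.symm.trans upper

variable (X) in
/-- The class in the `1`-chains modulo boundaries, as a cocycle. It is the universal one. -/
def edgeCocycle : PathCocycle X ((chains X).opcycles 1) where
  along := Quotient.lift edgeClass fun _ _ => edgeClass_eq_of_homotopic
  along_trans := by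
    rintro x y z ⟨γ⟩ ⟨γ'⟩
    exact edgeClass_trans γ γ'

theorem edgeClass_symm {x y : X} (γ : Path x y) : edgeClass γ.symm = -edgeClass γ :=
  (edgeCocycle X).along_symm γ

theorem edgeClass_cast {x y x' y' : X} (γ : Path x y) (hx : x' = x) (hy : y' = y) :
    edgeClass (γ.cast hx hy) = edgeClass γ :=
  (edgeCocycle X).along_congr fun _ => rfl

/-- A singular `1`-simplex, as a path. -/
def simplexPath (s : SingularSimplex X 1) :
    Path (s.toMap (stdSimplexHomeomorphUnitInterval.symm 0))
      (s.toMap (stdSimplexHomeomorphUnitInterval.symm 1)) where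
  toFun t := s.toMap (stdSimplexHomeomorphUnitInterval.symm t)
  continuous_toFun := s.toMap.continuous.comp stdSimplexHomeomorphUnitInterval.symm.continuous
  source' := rfl
  target' := rfl

theorem singularSimplex_simplexPath (s : SingularSimplex X 1) :
    singularSimplex (simplexPath s) = s :=
  (eq_singularSimplex fun _ => rfl).symm

theorem edgeClass_simplexPath (s : SingularSimplex X 1) :
    edgeClass (simplexPath s) = simplexClass s :=
  congr_arg simplexClass (singularSimplex_simplexPath s)

theorem PathCocycle.along_simplexPath_face_one {A : Type*} [AddCommGroup A] (c : PathCocycle X A)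
    (s : SingularSimplex X 2) :
    c.along (.mk (simplexPath (s.face 1))) =
      c.along (.mk (simplexPath (s.face 2))) + c.along (.mk (simplexPath (s.face 0))) :=
  c.along_triangle s.toMap (s.toMap_face 2) (s.toMap_face 0) (s.toMap_face 1)

theorem PathCocycle.exists_linearMap_edgeClass {A : Type u} [AddCommGroup A]
    (c : PathCocycle X A) :
    ∃ φ : (chains X).opcycles 1 →ₗ[ℤ] A,
      ∀ {x y : X} (γ : Path x y), φ (edgeClass γ) = c.along (.mk γ) := by
  obtain ⟨k, hk⟩ := exists_chains_linearMap fun s : SingularSimplex X 1 =>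
    c.along (.mk (simplexPath s))
  have d_comp : (chains X).d 2 1 ≫ ModuleCat.ofHom (Y := A) k = 0 := by
    refine ModuleCat.hom_ext (chains_linearMap_ext fun s => ?_)
    change k (((chains X).d 2 1).hom (basisChain s)) = 0
    rw [d_basisChain, map_sum, Fin.sum_univ_three]
    simp only [map_zsmul, hk, c.along_simplexPath_face_one s]
    simp
  let φ := (chains X).descOpcycles (ModuleCat.ofHom (Y := A) k) 2 (by simp) d_comp
  refine ⟨φ.hom, fun γ => ?_⟩
  have desc := (chains X).p_descOpcycles (ModuleCat.ofHom (Y := A) k) 2 (by simp) d_comp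
  exact congr(($desc).hom (basisChain (singularSimplex γ))).trans
    ((hk _).trans (c.along_congr (toMap_singularSimplex γ)))

variable (X) in
/-- The inclusion of the first homology into the `1`-chains modulo boundaries. -/
def toEdgeClasses : H1 X →ₗ[ℤ] (chains X).opcycles 1 :=
  ((chains X).homologyι 1).hom

theorem toEdgeClasses_injective : Function.Injective (toEdgeClasses X) :=
  (ModuleCat.mono_iff_injective ((chains X).homologyι 1)).1 inferInstance

theorem toEdgeClasses_loopClass {x : X} (γ : Path x x) :
    toEdgeClasses X (loopClass γ) = edgeClass γ := by
  have lift_π_ι : ((chains X).liftCycles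
      ((TopCat.toSSet.obj (TopCat.of X)).ιChainComplex (R := coeffs) (singularSimplex γ)) 0
        (by simp) (singularSimplex_d γ) ≫ (chains X).homologyπ 1) ≫ (chains X).homologyι 1 =
      (TopCat.toSSet.obj (TopCat.of X)).ιChainComplex (singularSimplex γ) ≫
        (chains X).pOpcycles 1 := by
    simp
  exact congr(($lift_π_ι).hom (ULift.up 1))

end Hurewicz

section Hurewicz

variable {X : Type u} [TopologicalSpace X]

theorem loopClass_eq_of_edgeClass_eq {x y : X} {γ : Path x x} {γ' : Path y y}
    (h : edgeClass γ = edgeClass γ') : loopClass γ = loopClass γ' :=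
  toEdgeClasses_injective (by rw [toEdgeClasses_loopClass, toEdgeClasses_loopClass, h])

theorem loopClass_trans {x : X} (γ γ' : Path x x) :
    loopClass (γ.trans γ') = loopClass γ + loopClass γ' :=
  toEdgeClasses_injective (by
    rw [map_add, toEdgeClasses_loopClass, toEdgeClasses_loopClass, toEdgeClasses_loopClass,
      edgeClass_trans])

theorem loopClass_refl (x : X) : loopClass (Path.refl x) = 0 :=
  toEdgeClasses_injective (by rw [toEdgeClasses_loopClass, edgeClass_refl, map_zero])

theorem loopClass_symm {x : X} (γ : Path x x) : loopClass γ.symm = -loopClass γ :=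
  toEdgeClasses_injective (by
    rw [map_neg, toEdgeClasses_loopClass, toEdgeClasses_loopClass, edgeClass_symm])

/-- The classes of the closed paths at `x`, as a subgroup of the first homology. -/
def loopClasses (x : X) : AddSubgroup (H1 X) where
  carrier := Set.range fun γ : Path x x => loopClass γ
  zero_mem' := ⟨Path.refl x, loopClass_refl x⟩
  add_mem' := by
    rintro _ _ ⟨γ, rfl⟩ ⟨γ', rfl⟩
    exact ⟨γ.trans γ', loopClass_trans γ γ'⟩
  neg_mem' := by
    rintro _ ⟨γ, rfl⟩
    exact ⟨γ.symm, loopClass_symm γ⟩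

theorem d_basisChain_simplex_one (s : SingularSimplex X 1) :
    ((chains X).d 1 0).hom (basisChain s) = basisChain (s.face 0) - basisChain (s.face 1) := by
  rw [d_basisChain, Fin.sum_univ_two]
  simp [sub_eq_add_neg]

theorem exists_loopClasses_boundary [PathConnectedSpace X] (x : X) :
    ∃ (Φ : (chains X).X 1 →ₗ[ℤ] H1 X) (Θ : (chains X).X 0 →ₗ[ℤ] (chains X).opcycles 1),
      (∀ c, Φ c ∈ loopClasses x) ∧ ∀ c, toEdgeClasses X (Φ c) =
        ((chains X).pOpcycles 1).hom c - Θ (((chains X).d 1 0).hom c) := by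
  let w : ∀ y, Path x y := PathConnectedSpace.somePath x
  obtain ⟨Φ, hΦ⟩ := exists_chains_linearMap (V := H1 X) fun s : SingularSimplex X 1 =>
    loopClass ((w _).trans ((simplexPath s).trans (w _).symm))
  obtain ⟨Θ, hΘ⟩ := exists_chains_linearMap (V := (chains X).opcycles 1)
    fun s : SingularSimplex X 0 => edgeClass (w (TopCat.toSSetObj₀Equiv s))
  refine ⟨Φ, Θ, fun c => ?_, fun c => ?_⟩
  · have hc : c ∈ Submodule.span ℤ (Set.range (basisChain (X := X) (k := 1))) :=
      span_range_basisChain.ge Submodule.mem_top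
    induction hc using Submodule.span_induction with
    | mem _ h =>
      obtain ⟨s, rfl⟩ := h
      exact hΦ s ▸ ⟨_, rfl⟩
    | zero => exact map_zero Φ ▸ zero_mem _
    | add c c' _ _ hc hc' => exact map_add Φ c c' ▸ add_mem hc hc'
    | smul k c _ hc =>
      exact (congr_arg (· ∈ loopClasses x) ((Φ.map_smul k c).trans
        (int_smul_eq_zsmul (H1 X).isModule k _))).mpr (zsmul_mem hc k)
  · suffices (toEdgeClasses X).comp Φ =
        ((chains X).pOpcycles 1).hom - Θ.comp ((chains X).d 1 0).hom from congr($this c)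
    refine chains_linearMap_ext fun s => ?_
    have source : TopCat.toSSetObj₀Equiv (s.face 1) =
        s.toMap (stdSimplexHomeomorphUnitInterval.symm 0) :=
      (TopCat.toSSetObj₁Equiv_apply_zero s).symm
    have target : TopCat.toSSetObj₀Equiv (s.face 0) =
        s.toMap (stdSimplexHomeomorphUnitInterval.symm 1) :=
      (TopCat.toSSetObj₁Equiv_apply_one s).symm
    rw [LinearMap.comp_apply, hΦ, LinearMap.sub_apply, LinearMap.comp_apply,
      d_basisChain_simplex_one, map_sub, hΘ, hΘ, toEdgeClasses_loopClass, edgeClass_trans,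
      edgeClass_trans, edgeClass_symm, edgeClass_simplexPath, source, target, simplexClass]
    abel

theorem exists_loopClass_eq [PathConnectedSpace X] (x : X) (z : H1 X) :
    ∃ γ : Path x x, loopClass γ = z := by
  obtain ⟨Φ, Θ, Φ_mem, toEdgeClasses_Φ⟩ := exists_loopClasses_boundary x
  obtain ⟨c, rfl⟩ := (ModuleCat.epi_iff_surjective ((chains X).homologyπ 1)).1 inferInstance z
  suffices Φ (((chains X).iCycles 1).hom c) = ((chains X).homologyπ 1).hom c from this ▸ Φ_mem _
  have d_eq_zero : ((chains X).d 1 0).hom (((chains X).iCycles 1).hom c) = 0 :=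
    congr(($((chains X).iCycles_d 1 0)).hom c)
  apply toEdgeClasses_injective
  rw [toEdgeClasses_Φ, d_eq_zero, map_zero, sub_zero]
  exact congr(($((chains X).homology_π_ι 1)).hom c).symm

/-- The cocycle which closes up a path by the chosen paths `w` and takes its class in the
abelianized fundamental group. -/
def closingCocycle {x₀ : X} (w : ∀ x, Path x₀ x) :
    PathCocycle X (Additive (Abelianization (FundamentalGroup X x₀))) where
  along {x y} γ := Additive.ofMul (Abelianization.of
    (FundamentalGroup.fromPath ((Path.Homotopic.Quotient.mk (w x)).trans
      (γ.trans (Path.Homotopic.Quotient.mk (w y)).symm))))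
  along_trans {x y z} γ γ' := by
    rw [add_comm, ← ofMul_mul, ← map_mul, FundamentalGroup.mul_def]
    congr 2
    let a (x : X) : FundamentalGroupoid.mk x₀ ⟶ FundamentalGroupoid.mk x := .mk (w x)
    let g : FundamentalGroupoid.mk x ⟶ FundamentalGroupoid.mk y := γ
    let g' : FundamentalGroupoid.mk y ⟶ FundamentalGroupoid.mk z := γ'
    change a x ≫ (g ≫ g') ≫ Groupoid.inv (a z) =
      (a x ≫ g ≫ Groupoid.inv (a y)) ≫ (a y ≫ g' ≫ Groupoid.inv (a z))
    simp

theorem closingCocycle_along_loop {x₀ : X} (w : ∀ x, Path x₀ x) (γ : FundamentalGroup X x₀) :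
    (closingCocycle w).along γ = Additive.ofMul (Abelianization.of γ) := by
  let a : FundamentalGroup X x₀ := FundamentalGroup.fromPath (.mk (w x₀))
  have conj : (closingCocycle w).along γ = Additive.ofMul (Abelianization.of (a⁻¹ * γ * a)) := rfl
  rw [conj, map_mul Abelianization.of, map_mul Abelianization.of, map_inv Abelianization.of,
    mul_comm, mul_inv_cancel_left]

theorem mem_commutator_of_loopClass_eq_zero [PathConnectedSpace X] {x : X} {γ : Path x x}
    (h : loopClass γ = 0) :
    FundamentalGroup.fromPath (.mk γ) ∈ commutator (FundamentalGroup X x) := by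
  let c := closingCocycle (PathConnectedSpace.somePath x)
  obtain ⟨φ, hφ⟩ := c.exists_linearMap_edgeClass
  have along_eq_zero : c.along (.mk γ) = 0 := by
    rw [← hφ, ← toEdgeClasses_loopClass, h, map_zero, map_zero]
  rw [closingCocycle_along_loop] at along_eq_zero
  exact (QuotientGroup.eq_one_iff _).1 along_eq_zero

namespace PathCocycle

variable [PathConnectedSpace X] {A : Type*} [AddCommGroup A] (c : PathCocycle X A)

theorem along_eq_of_loopClass_eq {x y : X} {γ : Path x x} {γ' : Path y y}
    (h : loopClass γ = loopClass γ') : c.along (.mk γ) = c.along (.mk γ') := by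
  let w : Path x y := PathConnectedSpace.somePath x y
  have edgeClass_eq : edgeClass γ = edgeClass γ' := by
    rw [← toEdgeClasses_loopClass, h, toEdgeClasses_loopClass]
  have loopClass_eq_zero : loopClass (γ.trans (w.trans (γ'.symm.trans w.symm))) = 0 :=
    toEdgeClasses_injective (by
      rw [toEdgeClasses_loopClass, map_zero, edgeClass_trans, edgeClass_trans, edgeClass_trans,
        edgeClass_symm, edgeClass_symm, edgeClass_eq]
      abel)
  have along_eq_zero := c.along_eq_zero_of_mem_commutator
    (mem_commutator_of_loopClass_eq_zero loopClass_eq_zero)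
  change c.along (.mk (γ.trans (w.trans (γ'.symm.trans w.symm)))) = 0 at along_eq_zero
  simp only [Path.Homotopic.Quotient.mk_trans, c.along_trans, c.along_symm] at along_eq_zero
  rw [← sub_eq_zero, ← along_eq_zero]
  abel

theorem exists_addMonoidHom_loopClass :
    ∃ φ : H1 X →+ A, ∀ {x : X} (γ : Path x x), φ (loopClass γ) = c.along (.mk γ) := by
  obtain ⟨x₀⟩ := ‹PathConnectedSpace X›.nonempty
  choose loop loopClass_loop using exists_loopClass_eq x₀
  refine ⟨AddMonoidHom.mk' (fun z => c.along (.mk (loop z))) fun z z' => ?_, fun γ =>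
    c.along_eq_of_loopClass_eq (loopClass_loop _)⟩
  rw [← c.along_trans, ← Path.Homotopic.Quotient.mk_trans]
  exact c.along_eq_of_loopClass_eq (by
    rw [loopClass_trans, loopClass_loop, loopClass_loop, loopClass_loop])

theorem along_eq_sum_repr {b : ℕ} (Γ : Module.Basis (Fin b) ℤ (H1 X)) (x₀ : X) {v : Fin b → A}
    (h : ∀ (j : Fin b) (γ : Path x₀ x₀), loopClass γ = Γ j → c.along (.mk γ) = v j)
    {x : X} (γ : Path x x) : c.along (.mk γ) = ∑ j, Γ.repr (loopClass γ) j • v j := by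
  obtain ⟨φ, hφ⟩ := c.exists_addMonoidHom_loopClass
  have φ_basis (j : Fin b) : φ (Γ j) = v j := by
    obtain ⟨γ, hγ⟩ := exists_loopClass_eq x₀ (Γ j)
    rw [← h j γ hγ, ← hφ, hγ]
  rw [← hφ, ← Γ.sum_repr (loopClass γ), map_sum, Γ.sum_repr]
  refine Finset.sum_congr rfl fun j _ => ?_
  rw [← φ_basis, ← map_zsmul]
  exact congr_arg φ (int_smul_eq_zsmul (H1 X).isModule _ _)

end PathCocycle

theorem toEdgeClasses_map {Y : Type u} [TopologicalSpace Y] (f : C(X, Y)) (z : H1 X) :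
    toEdgeClasses Y (H1.map f z) = (HomologicalComplex.opcyclesMap
      (SSet.chainComplexMap (TopCat.toSSet.map (TopCat.ofHom f)) coeffs) 1).hom
        (toEdgeClasses X z) :=
  congr(($(HomologicalComplex.homologyι_naturality
    (SSet.chainComplexMap (TopCat.toSSet.map (TopCat.ofHom f)) coeffs) 1)).hom z)

theorem H1.map_loopClass {Y : Type u} [TopologicalSpace Y] (f : C(X, Y)) {x : X}
    (γ : Path x x) : H1.map f (loopClass γ) = loopClass (γ.map f.continuous) := by
  let F := SSet.chainComplexMap (TopCat.toSSet.map (TopCat.ofHom f)) coeffs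
  apply toEdgeClasses_injective
  rw [toEdgeClasses_map, toEdgeClasses_loopClass, toEdgeClasses_loopClass]
  have p_map := congr(($(HomologicalComplex.p_opcyclesMap F 1)).hom
    (basisChain (singularSimplex γ)))
  have map_basisChain := congr(($(SSet.ι_chainComplexMap_f
    (f := TopCat.toSSet.map (TopCat.ofHom f)) (R := coeffs)
    (x := singularSimplex γ))).hom (ULift.up 1))
  exact p_map.trans congr(((chains Y).pOpcycles 1).hom $map_basisChain)

theorem H1.map_comp {Y Z : Type u} [TopologicalSpace Y] [TopologicalSpace Z] (g : C(Y, Z))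
    (f : C(X, Y)) : H1.map (g.comp f) = H1.map g ∘ₗ H1.map f :=
  congr_arg ModuleCat.Hom.hom (((singularHomologyFunctor (ModuleCat.{u} ℤ) 1).obj
    (ModuleCat.of ℤ (ULift.{u} ℤ))).map_comp (TopCat.ofHom f) (TopCat.ofHom g))

theorem H1.map_id : H1.map (ContinuousMap.id X) = LinearMap.id :=
  congr_arg ModuleCat.Hom.hom (((singularHomologyFunctor (ModuleCat.{u} ℤ) 1).obj
    (ModuleCat.of ℤ (ULift.{u} ℤ))).map_id (TopCat.of X))

theorem det_homologyMatrix_ne_zero {b : ℕ} (Γ : Module.Basis (Fin b) ℤ (H1 X)) (h : X ≃ₜ X) :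
    (homologyMatrix Γ (h : C(X, X))).det ≠ 0 := by
  have mul_eq_one :
      homologyMatrix Γ (h.symm : C(X, X)) * homologyMatrix Γ (h : C(X, X)) = 1 := by
    rw [homologyMatrix, homologyMatrix, ← LinearMap.toMatrix_comp, ← H1.map_comp,
      Homeomorph.symm_comp_toContinuousMap, H1.map_id, LinearMap.toMatrix_id]
  intro det_eq_zero
  have det_mul := congr_arg Matrix.det mul_eq_one
  rw [Matrix.det_mul, det_eq_zero, mul_zero, Matrix.det_one] at det_mul
  exact zero_ne_one det_mul

end Hurewicz

namespace IsUniversalAbelianCover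

variable {N : Type v} {M : Type u} [TopologicalSpace N] [TopologicalSpace M] {p : C(N, M)}

theorem along_map_eq (hp : IsUniversalAbelianCover p) {A : Type*} [AddCommGroup A]
    (c : PathCocycle M A) {x y : N} (γ γ' : Path x y) :
    c.along (.mk (γ.map p.continuous)) = c.along (.mk (γ'.map p.continuous)) :=
  c.along_map_eq (hp.range_map x).le γ γ'

theorem eq_of_edgeClass_map (hp : IsUniversalAbelianCover p) [PathConnectedSpace M] {x y : N}
    (h : p x = p y) {γ : Path x y} (hγ : edgeClass (γ.map p.continuous) = 0) : x = y := by
  let σ : Path (p x) (p x) := (γ.map p.continuous).cast rfl h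
  have loopClass_eq_zero : loopClass σ = 0 := toEdgeClasses_injective (by
    rw [toEdgeClasses_loopClass, edgeClass_cast, hγ, map_zero])
  have mem_range := mem_commutator_of_loopClass_eq_zero loopClass_eq_zero
  rw [← hp.range_map x] at mem_range
  obtain ⟨⟨τ⟩, hτ⟩ := mem_range
  have closed : hp.covering.monodromy (.mk σ) ⟨x, rfl⟩ = ⟨x, rfl⟩ :=
    hp.covering.monodromy_eq_of_map_eq (Γ := .mk τ) hτ
  have endpoint : hp.covering.monodromy (.mk σ) ⟨x, rfl⟩ = ⟨y, h.symm⟩ :=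
    hp.covering.monodromy_eq_of_map_eq (Γ := .mk γ) rfl
  exact congr_arg Subtype.val (closed.symm.trans endpoint)

end IsUniversalAbelianCover

/-! ### Integration of local primitives -/

section LocalPrimitives

/-- A copy of `V` with the discrete topology, the fibre of the bundle of germs of primitives. -/
def DiscreteCopy (V : Type*) : Type _ := V

/-- An element of `V`, seen in the discrete copy. -/
def DiscreteCopy.of {V : Type*} (v : V) : DiscreteCopy V := v

/-- An element of the discrete copy, seen in `V`. -/
def DiscreteCopy.get {V : Type*} (v : DiscreteCopy V) : V := v

instance {V : Type*} : TopologicalSpace (DiscreteCopy V) := ⊥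

instance {V : Type*} : DiscreteTopology (DiscreteCopy V) := ⟨rfl⟩

/-- A family of continuous functions on open sets which cover `M`, any two of which differ by a
locally constant function: the primitives of a closed form, without the form. -/
structure LocalPrimitives (ι M V : Type*) [TopologicalSpace M] [TopologicalSpace V]
    [AddCommGroup V] where
  dom : ι → Set M
  isOpen_dom : ∀ i, IsOpen (dom i)
  index : M → ι
  mem_dom : ∀ x, x ∈ dom (index x)
  fn : ι → M → V
  continuousOn_fn : ∀ i, ContinuousOn (fn i) (dom i)
  locConst : ∀ i k x, x ∈ dom i → x ∈ dom k → ∀ᶠ y in 𝓝 x, fn i y - fn k y = fn i x - fn k x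

namespace LocalPrimitives

variable {ι M V : Type*} [TopologicalSpace M] [TopologicalSpace V] [AddCommGroup V]
  (S : LocalPrimitives ι M V)

/-- A function which differs from each local primitive along `f` by a locally constant function. -/
def IsPrimitiveAlong {A : Type*} [TopologicalSpace A] (f : A → M) (g : A → V) : Prop :=
  ∀ a i, f a ∈ S.dom i → ∀ᶠ c in 𝓝 a, g c - S.fn i (f c) = g a - S.fn i (f a)

theorem isPrimitiveAlong_fn {A : Type*} [TopologicalSpace A] {f : A → M} (hf : Continuous f)
    {i : ι} (h : ∀ a, f a ∈ S.dom i) : S.IsPrimitiveAlong f fun a => S.fn i (f a) :=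
  fun a k ha => hf.continuousAt.eventually (S.locConst i k (f a) (h a) ha)

variable {S}

theorem IsPrimitiveAlong.comp {A B : Type*} [TopologicalSpace A] [TopologicalSpace B]
    {f : A → M} {g : A → V} (h : S.IsPrimitiveAlong f g) {k : B → A} (hk : Continuous k) :
    S.IsPrimitiveAlong (f ∘ k) (g ∘ k) :=
  fun a i ha => hk.continuousAt.eventually (h (k a) i ha)

theorem IsPrimitiveAlong.continuous [IsTopologicalAddGroup V] {A : Type*} [TopologicalSpace A]
    {f : A → M} {g : A → V} (h : S.IsPrimitiveAlong f g) (hf : Continuous f) : Continuous g := by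
  refine continuous_iff_continuousAt.2 fun a => ?_
  have mem_dom := S.mem_dom (f a)
  have continuousAt_fn : ContinuousAt (fun c => S.fn (S.index (f a)) (f c)) a :=
    ContinuousAt.comp (f := f) ((S.continuousOn_fn _).continuousAt
      ((S.isOpen_dom _).mem_nhds mem_dom)) hf.continuousAt
  refine ((continuousAt_const (y := g a - S.fn (S.index (f a)) (f a))).add continuousAt_fn).congr ?_
  filter_upwards [h a _ mem_dom] with c hc
  rw [← hc]
  exact sub_add_cancel _ _

theorem IsPrimitiveAlong.sub_eq_sub {A : Type*} [TopologicalSpace A] [PreconnectedSpace A]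
    {f : A → M} {g g' : A → V} (h : S.IsPrimitiveAlong f g) (h' : S.IsPrimitiveAlong f g')
    (a c : A) : g c - g a = g' c - g' a := by
  have isLocallyConstant_sub : IsLocallyConstant (g - g') := by
    refine (IsLocallyConstant.iff_eventually_eq _).2 fun a => ?_
    filter_upwards [h a _ (S.mem_dom (f a)), h' a _ (S.mem_dom (f a))] with c hc hc'
    simpa using congr_arg₂ (· - ·) hc hc'
  exact sub_eq_sub_iff_sub_eq_sub.1 (isLocallyConstant_sub.apply_eq_of_preconnectedSpace c a)

variable (S)

/-- The fibre bundle core with discrete fibre whose local sections are the primitives. -/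
def core : FiberBundleCore ι M (DiscreteCopy V) where
  baseSet := S.dom
  isOpen_baseSet := S.isOpen_dom
  indexAt := S.index
  mem_baseSet_at := S.mem_dom
  coordChange i k x v := DiscreteCopy.of (v.get + (S.fn i x - S.fn k x))
  coordChange_self i x _ v := by
    rw [sub_self]
    exact add_zero v.get
  continuousOn_coordChange i k := by
    rintro ⟨x, v⟩ ⟨⟨hi, hk⟩, -⟩
    refine ContinuousAt.continuousWithinAt ?_
    refine (continuousAt_const (y := DiscreteCopy.of (v.get + (S.fn i x - S.fn k x)))).congr ?_
    have sub_const : ∀ᶠ q : M × DiscreteCopy V in 𝓝 (x, v),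
        S.fn i q.1 - S.fn k q.1 = S.fn i x - S.fn k x :=
      continuousAt_fst.eventually (p := fun y => S.fn i y - S.fn k y = S.fn i x - S.fn k x)
        (S.locConst i k x hi hk)
    have snd_const : ∀ᶠ q : M × DiscreteCopy V in 𝓝 (x, v), q.2 = v :=
      continuousAt_snd.eventually (p := fun w => w = v) (by simp [nhds_discrete])
    filter_upwards [sub_const, snd_const] with q hfst hsnd
    rw [hfst, hsnd]
  coordChange_comp i k l x _ v := by
    change v.get + (S.fn i x - S.fn k x) + (S.fn k x - S.fn l x) = v.get + (S.fn i x - S.fn l x)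
    rw [add_assoc, sub_add_sub_cancel]

/-- The covering space of germs of primitives. -/
abbrev Germs : Type _ := S.core.TotalSpace

theorem isCoveringMap_proj : IsCoveringMap S.core.proj :=
  FiberBundle.isCoveringMap

/-- The value of a germ of a primitive. -/
def val (e : S.Germs) : V := DiscreteCopy.get e.2 + S.fn (S.index e.1) e.1

theorem localTriv_snd (i : ι) (e : S.Germs) :
    (S.core.localTriv i e).2 = DiscreteCopy.of (S.val e - S.fn i (S.core.proj e)) :=
  (add_sub_assoc (DiscreteCopy.get e.2) (S.fn (S.index e.1) e.1) (S.fn i e.1)).symm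

theorem isPrimitiveAlong_val : S.IsPrimitiveAlong S.core.proj S.val := by
  intro e i he
  have continuousAt_localTriv : ContinuousAt (S.core.localTriv i) e :=
    (S.core.localTriv i).continuousAt ((S.core.mem_localTriv_source i e).2 he)
  have snd_const : ∀ᶠ c in 𝓝 e, (S.core.localTriv i c).2 = (S.core.localTriv i e).2 :=
    (continuousAt_snd.comp continuousAt_localTriv).eventually
      (p := fun w => w = (S.core.localTriv i e).2) (by rw [nhds_discrete]; exact rfl)
  filter_upwards [snd_const] with c hc
  rw [localTriv_snd, localTriv_snd] at hc
  exact hc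

theorem val_monodromy {x y : M} {γ : Path x y} (e : S.core.proj ⁻¹' {x}) {g : unitInterval → V}
    (hg : S.IsPrimitiveAlong γ g) :
    S.val (S.isCoveringMap_proj.monodromy (.mk γ) e) = S.val e + (g 1 - g 0) := by
  have source : γ 0 = S.core.proj e := γ.source.trans e.2.symm
  have primitive_lift := S.isPrimitiveAlong_val.comp
    (S.isCoveringMap_proj.liftPath γ e source).continuous
  rw [S.isCoveringMap_proj.liftPath_lifts] at primitive_lift
  rw [hg.sub_eq_sub primitive_lift 0 1, Function.comp_apply, Function.comp_apply,
    S.isCoveringMap_proj.liftPath_zero, add_sub_cancel]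
  rfl

/-- The increment of the germs of primitives under monodromy; it is computed with one germ, but
does not depend on it. -/
def increment {x y : M} (γ : Path.Homotopic.Quotient x y) : V :=
  let e : S.core.proj ⁻¹' {x} := ⟨⟨x, DiscreteCopy.of 0⟩, rfl⟩
  S.val (S.isCoveringMap_proj.monodromy γ e) - S.val e

theorem increment_eq {x y : M} {γ : Path x y} {g : unitInterval → V}
    (hg : S.IsPrimitiveAlong γ g) : S.increment (.mk γ) = g 1 - g 0 := by
  rw [increment, S.val_monodromy _ hg, add_sub_cancel_left]

theorem val_monodromy_eq_add_increment {x y : M} (γ : Path.Homotopic.Quotient x y)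
    (e : S.core.proj ⁻¹' {x}) :
    S.val (S.isCoveringMap_proj.monodromy γ e) = S.val e + S.increment γ := by
  obtain ⟨γ⟩ := γ
  have source : γ 0 = S.core.proj e := γ.source.trans e.2.symm
  have primitive_lift := S.isPrimitiveAlong_val.comp
    (S.isCoveringMap_proj.liftPath γ e source).continuous
  rw [S.isCoveringMap_proj.liftPath_lifts] at primitive_lift
  exact (S.val_monodromy e primitive_lift).trans
    (congr_arg _ (S.increment_eq primitive_lift).symm)

/-- The integral along paths of the closed form with the given local primitives. -/
def integral : PathCocycle M V where
  along γ := S.increment γ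
  along_trans {x y z} γ γ' := by
    let e : S.core.proj ⁻¹' {x} := ⟨⟨x, DiscreteCopy.of 0⟩, rfl⟩
    have monodromy_trans := S.val_monodromy_eq_add_increment (γ.trans γ') e
    rw [IsCoveringMap.monodromy_trans_apply, val_monodromy_eq_add_increment,
      val_monodromy_eq_add_increment, add_assoc] at monodromy_trans
    exact (add_left_cancel monodromy_trans).symm

theorem integral_along {x y : M} {γ : Path x y} {g : unitInterval → V}
    (hg : S.IsPrimitiveAlong γ g) : S.integral.along (.mk γ) = g 1 - g 0 :=
  S.increment_eq hg

theorem exists_primitiveAlong {N : Type*} [TopologicalSpace N] [PathConnectedSpace N]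
    [LocallyPathConnectedSpace N] {p : C(N, M)} {x₀ : N}
    (hp : (FundamentalGroup.map p x₀).range ≤ commutator (FundamentalGroup M (p x₀))) :
    ∃ g : N → V, g x₀ = 0 ∧ S.IsPrimitiveAlong p g := by
  let g (x : N) : V :=
    S.integral.along (.mk ((PathConnectedSpace.somePath x₀ x).map p.continuous))
  have g_eq {x : N} (γ : Path x₀ x) : g x = S.integral.along (.mk (γ.map p.continuous)) :=
    S.integral.along_map_eq hp _ _
  have g_eq_add {x y : N} (γ : Path x y) :
      g y = g x + S.integral.along (.mk (γ.map p.continuous)) := by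
    rw [g_eq ((PathConnectedSpace.somePath x₀ x).trans γ), Path.map_trans,
      Path.Homotopic.Quotient.mk_trans, S.integral.along_trans]
  refine ⟨g, (g_eq (Path.refl x₀)).trans (S.integral.along_refl (p x₀)), fun x i hx => ?_⟩
  have isOpen_preimage : IsOpen (p ⁻¹' S.dom i) := (S.isOpen_dom i).preimage p.continuous
  filter_upwards [pathComponentIn_mem_nhds (isOpen_preimage.mem_nhds hx)] with y hy
  obtain ⟨γ, hγ⟩ := hy
  rw [g_eq_add γ, S.integral_along
    (S.isPrimitiveAlong_fn (γ.map p.continuous).continuous hγ), Path.source, Path.target]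
  abel

end LocalPrimitives

end LocalPrimitives

/-! ### Closed one-forms -/

section Forms

variable {n : ℕ} {M : Type u} [TopologicalSpace M] [ChartedSpace (EuclideanSpace ℝ (Fin n)) M]

/-- `Q` is a `C^1` primitive of `η` on `U`. -/
structure IsPrimitiveOn (η : CovectorField n M) (Q : M → ℝ) (U : Set M) : Prop where
  contMDiffOn : ContMDiffOn (𝓡 n) 𝓘(ℝ, ℝ) 1 Q U
  hasMFDerivAt : ∀ y ∈ U, HasMFDerivAt (𝓡 n) 𝓘(ℝ, ℝ) Q y (η y)

namespace IsPrimitiveOn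

variable {η : CovectorField n M} {Q : M → ℝ} {U : Set M}

theorem mono (hQ : IsPrimitiveOn η Q U) {V : Set M} (hV : V ⊆ U) : IsPrimitiveOn η Q V :=
  ⟨hQ.contMDiffOn.mono hV, fun y hy => hQ.hasMFDerivAt y (hV hy)⟩

theorem contDiffWithinAt_comp (hQ : IsPrimitiveOn η Q U) (hU : IsOpen U) {c : ℝ → M} {s : Set ℝ}
    {t : ℝ} (hc : ContMDiffWithinAt 𝓘(ℝ, ℝ) (𝓡 n) 1 c s t) (ht : c t ∈ U) :
    ContDiffWithinAt ℝ 1 (Q ∘ c) s t :=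
  contMDiffWithinAt_iff_contDiffWithinAt.1 <|
    (hQ.contMDiffOn.contMDiffAt (hU.mem_nhds ht)).comp_contMDiffWithinAt t hc

theorem hasDerivWithinAt_comp (hQ : IsPrimitiveOn η Q U) {c : ℝ → M} {s : Set ℝ} {t : ℝ}
    (hc : MDifferentiableWithinAt 𝓘(ℝ, ℝ) (𝓡 n) c s t) (ht : c t ∈ U) :
    HasDerivWithinAt (Q ∘ c) (η (c t) (mfderivWithin 𝓘(ℝ, ℝ) (𝓡 n) c s t (1 : ℝ))) s t := by
  have hderiv : HasFDerivWithinAt (Q ∘ c)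
      ((η (c t)).comp (mfderivWithin 𝓘(ℝ, ℝ) (𝓡 n) c s t) : ℝ →L[ℝ] ℝ) s t :=
    (HasMFDerivAt.comp_hasMFDerivWithinAt t (hQ.hasMFDerivAt _ ht)
      hc.hasMFDerivWithinAt).hasFDerivWithinAt
  exact hderiv.hasDerivWithinAt

end IsPrimitiveOn

section Manifold

variable [IsManifold (𝓡 n) ∞ M]

theorem localForm_comp_mfderiv (η : CovectorField n M) (x : M) {y : M}
    (hy : y ∈ (extChartAt (𝓡 n) x).source) :
    (localForm η x (extChartAt (𝓡 n) x y)).comp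
      (mfderiv (𝓡 n) 𝓘(ℝ, EuclideanSpace ℝ (Fin n)) (extChartAt (𝓡 n) x) y) = η y := by
  have : IsManifold (𝓡 n) 1 M := IsManifold.of_le (n := ∞) (by norm_num)
  have hinv := mfderivWithin_extChartAt_symm_comp_mfderiv_extChartAt' (I := 𝓡 n) hy
  rw [ModelWithCorners.range_eq_univ, mfderivWithin_univ] at hinv
  have η_congr : ∀ y', y' = y → ∀ v : EuclideanSpace ℝ (Fin n), η y' v = η y v := by
    rintro _ rfl v
    rfl
  ext v
  refine Eq.trans ?_ (η_congr _ ((extChartAt (𝓡 n) x).left_inv hy) v)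
  exact congr_arg (η ((extChartAt (𝓡 n) x).symm (extChartAt (𝓡 n) x y))) congr($hinv v)

theorem IsClosedOneForm.exists_isPrimitiveOn {η : CovectorField n M} (hη : IsClosedOneForm η)
    (x : M) : ∃ (U : Set M) (Q : M → ℝ), IsOpen U ∧ x ∈ U ∧ IsPrimitiveOn η Q U := by
  have : IsManifold (𝓡 n) 1 M := IsManifold.of_le (n := ∞) (by norm_num)
  let e := extChartAt (𝓡 n) x
  obtain ⟨r, hr, hball⟩ := Metric.isOpen_iff.1 (isOpen_extChartAt_target (I := 𝓡 n) x) (e x)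
    (mem_extChartAt_target x)
  obtain ⟨P, hP⟩ := (convex_ball (e x) r).exists_forall_hasFDerivAt_of_fderiv_symmetric
    Metric.isOpen_ball (((hη.smooth x).differentiableOn (by simp)).mono hball)
    fun a ha v w => hη.closed x a (hball ha) v w
  have hP_contDiff : ContDiffOn ℝ 1 P (Metric.ball (e x) r) := by
    rw [show (1 : WithTop ℕ∞) = 0 + 1 from rfl,
      contDiffOn_succ_iff_hasFDerivWithinAt_of_uniqueDiffOn Metric.isOpen_ball.uniqueDiffOn]
    exact ⟨by simp, localForm η x, ((hη.smooth x).mono hball).of_le (by simp),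
      fun z hz => (hP z hz).hasFDerivWithinAt⟩
  refine ⟨e.source ∩ e ⁻¹' Metric.ball (e x) r, P ∘ e,
    isOpen_extChartAt_preimage' x Metric.isOpen_ball,
    ⟨mem_extChartAt_source x, Metric.mem_ball_self hr⟩, ?_, fun y hy => ?_⟩
  · exact hP_contDiff.contMDiffOn.comp ((contMDiffOn_extChartAt (n := 1)).mono fun y hy => by
      simpa [e] using hy.1) fun y hy => hy.2
  · have he : HasMFDerivAt (𝓡 n) 𝓘(ℝ, EuclideanSpace ℝ (Fin n)) e y
        (mfderiv (𝓡 n) 𝓘(ℝ, EuclideanSpace ℝ (Fin n)) e y) :=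
      (mdifferentiableAt_extChartAt (by simpa [e] using hy.1)).hasMFDerivAt
    have hcomp := (hP (e y) hy.2).hasMFDerivAt.comp y he
    exact hcomp.congr_mfderiv (localForm_comp_mfderiv η x hy.1)

theorem eventually_eq_of_hasMFDerivAt_zero {D : M → ℝ} {W : Set M}
    (hW : IsOpen W) (hD : ∀ y ∈ W, HasMFDerivAt (𝓡 n) 𝓘(ℝ, ℝ) D y 0) {x : M} (hx : x ∈ W) :
    ∀ᶠ y in 𝓝 x, D y = D x := by
  have : IsManifold (𝓡 n) 1 M := IsManifold.of_le (n := ∞) (by norm_num)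
  let e := extChartAt (𝓡 n) x
  have hopen : IsOpen (e.target ∩ e.symm ⁻¹' W) :=
    (continuousOn_extChartAt_symm x).isOpen_inter_preimage (isOpen_extChartAt_target x) hW
  obtain ⟨r, hr, hball⟩ := Metric.isOpen_iff.1 hopen (e x)
    ⟨mem_extChartAt_target x, by simpa [e] using hx⟩
  have hderiv : ∀ z ∈ Metric.ball (e x) r, HasFDerivAt (𝕜 := ℝ) (D ∘ e.symm)
      (0 : EuclideanSpace ℝ (Fin n) →L[ℝ] ℝ) z := by
    intro z hz
    have he := mdifferentiableWithinAt_extChartAt_symm (I := 𝓡 n) (hball hz).1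
    rw [ModelWithCorners.range_eq_univ, mdifferentiableWithinAt_univ] at he
    have hcomp := HasMFDerivAt.comp (I' := 𝓡 n) (g := D) (I'' := 𝓘(ℝ, ℝ)) z
      (hD _ (hball hz).2) he.hasMFDerivAt
    rw [ContinuousLinearMap.zero_comp] at hcomp
    exact hcomp.hasFDerivAt
  have hconst : ∀ z ∈ Metric.ball (e x) r, D (e.symm z) = D x := by
    intro z hz
    have := Metric.isOpen_ball.is_const_of_fderiv_eq_zero (𝕜 := ℝ)
      (convex_ball (e x) r).isPreconnected
      (fun z hz => (hderiv z hz).differentiableAt.differentiableWithinAt)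
      (fun z hz => (hderiv z hz).fderiv) hz (Metric.mem_ball_self hr)
    simpa [e] using this
  filter_upwards [(isOpen_extChartAt_preimage' x Metric.isOpen_ball).mem_nhds
    ⟨mem_extChartAt_source (I := 𝓡 n) x, Metric.mem_ball_self hr⟩] with y hy
  rw [← hconst _ hy.2, e.left_inv hy.1]

theorem IsPrimitiveOn.eventually_sub_eq_sub {η : CovectorField n M} {Q Q' : M → ℝ} {U U' : Set M}
    (h : IsPrimitiveOn η Q U) (h' : IsPrimitiveOn η Q' U') (hU : IsOpen U) (hU' : IsOpen U')
    {x : M} (hx : x ∈ U) (hx' : x ∈ U') : ∀ᶠ y in 𝓝 x, Q y - Q' y = Q x - Q' x := by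
  refine eventually_eq_of_hasMFDerivAt_zero (n := n) (D := Q - Q') (hU.inter hU')
    (fun y hy => ?_) ⟨hx, hx'⟩
  exact ((h.hasMFDerivAt y hy.1).sub (h'.hasMFDerivAt y hy.2)).congr_mfderiv (sub_self _)

theorem exists_localPrimitives {ι : Type*} [Finite ι] {η : ι → CovectorField n M}
    (hη : ∀ i, IsClosedOneForm (η i)) :
    ∃ S : LocalPrimitives M M (ι → ℝ),
      ∀ x i, IsPrimitiveOn (η i) (fun y => S.fn x y i) (S.dom x) := by
  choose U Q hU hx hQ using fun x i => (hη i).exists_isPrimitiveOn x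
  have hQ' : ∀ x i, IsPrimitiveOn (η i) (Q x i) (⋂ k, U x k) := fun x i =>
    (hQ x i).mono (Set.iInter_subset _ i)
  have ho : ∀ x, IsOpen (⋂ k, U x k) := fun x => isOpen_iInter_of_finite (hU x)
  refine ⟨⟨fun x => ⋂ k, U x k, ho, id, fun x => Set.mem_iInter.2 (hx x),
    fun x y i => Q x i y, fun x => continuousOn_pi.2 fun i => (hQ' x i).contMDiffOn.continuousOn,
    fun x z y hy hz => ?_⟩, hQ'⟩
  filter_upwards [Filter.eventually_all.2 fun i =>
    (hQ' x i).eventually_sub_eq_sub (hQ' z i) (ho x) (ho z) hy hz] with w hw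
  ext i
  exact hw i

end Manifold

section LineIntegral

variable {ι : Type*} {η : ι → CovectorField n M} {S : LocalPrimitives M M (ι → ℝ)}
  {x y : M} {γ : Path x y} {g : unitInterval → ι → ℝ}

theorem LocalPrimitives.IsPrimitiveAlong.extend_eventuallyEq (hg : S.IsPrimitiveAlong γ g)
    {t : ℝ} {k : M} (hk : γ.extend t ∈ S.dom k) (i : ι) :
    (fun s => g (Set.projIcc 0 1 zero_le_one s) i) =ᶠ[𝓝 t]
      fun s => S.fn k (γ.extend s) i +
        (g (Set.projIcc 0 1 zero_le_one t) i - S.fn k (γ.extend t) i) := by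
  filter_upwards [(continuous_projIcc (h := zero_le_one (α := ℝ))).continuousAt.eventually
    (hg (Set.projIcc 0 1 zero_le_one t) k hk)] with s hs
  have hsi := congr_fun hs i
  simp only [Pi.sub_apply] at hsi
  change _ = S.fn k (γ (Set.projIcc 0 1 zero_le_one s)) i +
    (g (Set.projIcc 0 1 zero_le_one t) i - S.fn k (γ (Set.projIcc 0 1 zero_le_one t)) i)
  linarith

theorem lineIntegral_eq_sub (hS : ∀ x i, IsPrimitiveOn (η i) (fun y => S.fn x y i) (S.dom x))
    (hγ : IsSmoothPath (n := n) γ) (hg : S.IsPrimitiveAlong γ g) (i : ι) :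
    lineIntegral (η i) γ = g 1 i - g 0 i := by
  let G : ℝ → ℝ := fun t => g (Set.projIcc 0 1 zero_le_one t) i
  have hG_contDiff : ContDiffOn ℝ 1 G (Set.Icc 0 1) := fun t ht => by
    have hlocal := hg.extend_eventuallyEq (S.mem_dom (γ.extend t)) i
    exact (((hS _ i).contDiffWithinAt_comp (S.isOpen_dom _) ((hγ t ht).of_le (by simp))
      (S.mem_dom _)).add contDiffWithinAt_const).congr_of_eventuallyEq
        (hlocal.filter_mono nhdsWithin_le_nhds) hlocal.self_of_nhds
  have hG_deriv : ∀ t ∈ Set.Icc (0 : ℝ) 1, HasDerivWithinAt G (η i (γ.extend t)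
      (mfderivWithin 𝓘(ℝ, ℝ) (𝓡 n) γ.extend (Set.Icc 0 1) t (1 : ℝ))) (Set.Icc 0 1) t := by
    intro t ht
    have hlocal := hg.extend_eventuallyEq (S.mem_dom (γ.extend t)) i
    exact (((hS _ i).hasDerivWithinAt_comp ((hγ t ht).mdifferentiableWithinAt (by simp))
      (S.mem_dom _)).add_const _).congr_of_eventuallyEq
        (hlocal.filter_mono nhdsWithin_le_nhds) hlocal.self_of_nhds
  calc lineIntegral (η i) γ = ∫ t in (0 : ℝ)..1, derivWithin G (Set.Icc 0 1) t := by
        refine intervalIntegral.integral_congr fun t ht => ?_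
        rw [Set.uIcc_of_le zero_le_one] at ht
        exact ((hG_deriv t ht).derivWithin (uniqueDiffOn_Icc_zero_one t ht)).symm
    _ = G 1 - G 0 :=
        intervalIntegral.integral_derivWithin_Icc_of_contDiffOn_Icc hG_contDiff zero_le_one
    _ = g 1 i - g 0 i := by simp [G]

end LineIntegral

end Forms

/-! ### Smooth paths -/

section FlatSegment

variable {E : Type*} [NormedAddCommGroup E] [NormedSpace ℝ E]

/-- The segment from `a` to `b`, parametrized smoothly on `ℝ` so that it rests at `a` until `1 / 3`
and at `b` from `2 / 3` on. -/
def flatSegment (a b : E) (t : ℝ) : E :=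
  AffineMap.lineMap a b (Real.smoothTransition (3 * t - 1))

theorem contDiff_flatSegment (a b : E) : ContDiff ℝ ∞ (flatSegment a b) := by
  have hparam : ContDiff ℝ ∞ fun t : ℝ => Real.smoothTransition (3 * t - 1) :=
    Real.smoothTransition.contDiff.comp ((contDiff_const.mul contDiff_id).sub contDiff_const)
  change ContDiff ℝ ∞ fun t => AffineMap.lineMap a b (Real.smoothTransition (3 * t - 1))
  simp only [AffineMap.lineMap_apply_module]
  exact ((contDiff_const.sub hparam).smul contDiff_const).add (hparam.smul contDiff_const)

theorem flatSegment_of_le (a b : E) {t : ℝ} (ht : t ≤ 1 / 3) : flatSegment a b t = a := by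
  rw [flatSegment, Real.smoothTransition.zero_of_nonpos (by linarith), AffineMap.lineMap_apply_zero]

theorem flatSegment_of_ge (a b : E) {t : ℝ} (ht : 2 / 3 ≤ t) : flatSegment a b t = b := by
  rw [flatSegment, Real.smoothTransition.one_of_one_le (by linarith), AffineMap.lineMap_apply_one]

theorem flatSegment_mem {s : Set E} (hs : Convex ℝ s) {a b : E} (ha : a ∈ s)
    (hb : b ∈ s) (t : ℝ) : flatSegment a b t ∈ s :=
  hs.lineMap_mem ha hb ⟨Real.smoothTransition.nonneg _, Real.smoothTransition.le_one _⟩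

end FlatSegment

section FlatPath

variable {n : ℕ} {M : Type u} [TopologicalSpace M] [ChartedSpace (EuclideanSpace ℝ (Fin n)) M]
  {x y z : M}

/-- The path is the restriction of a smooth curve which is constant near the end points, so that
such paths can be concatenated. -/
structure IsFlatPath (n : ℕ) {M : Type u} [TopologicalSpace M]
    [ChartedSpace (EuclideanSpace ℝ (Fin n)) M] {x y : M} (γ : Path x y) : Prop where
  smooth : ContMDiff 𝓘(ℝ, ℝ) (𝓡 n) ∞ γ.extend
  left : ∀ᶠ t in 𝓝 (0 : ℝ), γ.extend t = x
  right : ∀ᶠ t in 𝓝 (1 : ℝ), γ.extend t = y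

namespace IsFlatPath

theorem isSmoothPath {γ : Path x y} (h : IsFlatPath n γ) : IsSmoothPath (n := n) γ :=
  h.smooth.contMDiffOn

theorem refl (x : M) : IsFlatPath n (Path.refl x) := by
  refine ⟨?_, by simp, by simp⟩
  rw [show ⇑(Path.refl x).extend = fun _ => x by ext; simp]
  exact contMDiff_const

theorem of_curve {c : ℝ → M} (hc : ContMDiff 𝓘(ℝ, ℝ) (𝓡 n) ∞ c) (hx : ∀ t ≤ 1 / 3, c t = x)
    (hy : ∀ t, 2 / 3 ≤ t → c t = y) {γ : Path x y} (hγ : ∀ t : unitInterval, γ t = c t) :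
    IsFlatPath n γ := by
  have hextend : ⇑γ.extend = c := by
    ext t
    rcases le_total t 0 with ht | ht
    · rw [Path.extend_of_le_zero _ ht, hx t (by linarith)]
    rcases le_total t 1 with ht' | ht'
    · rw [Path.extend_apply _ ⟨ht, ht'⟩, hγ]
    · rw [Path.extend_of_one_le _ ht', hy t (by linarith)]
  refine ⟨?_, ?_, ?_⟩ <;> rw [hextend]
  · exact hc
  · filter_upwards [Iio_mem_nhds (show (0 : ℝ) < 1 / 3 by norm_num)] with t ht
    exact hx t ht.le
  · filter_upwards [Ioi_mem_nhds (show (2 / 3 : ℝ) < 1 by norm_num)] with t ht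
    exact hy t ht.le

theorem trans {γ : Path x y} {γ' : Path y z} (h : IsFlatPath n γ) (h' : IsFlatPath n γ') :
    IsFlatPath n (γ.trans γ') := by
  have extend_left : ∀ t : ℝ, t ≤ 1 / 2 → (γ.trans γ').extend t = γ.extend (2 * t) := fun t ht =>
    Path.extend_trans_of_le_half γ γ' ht
  have extend_right : ∀ t : ℝ, 1 / 2 ≤ t → (γ.trans γ').extend t = γ'.extend (2 * t - 1) :=
    fun t ht => Path.extend_trans_of_half_le γ γ' ht
  have left_tendsto : ∀ t s : ℝ, 2 * t = s → Filter.Tendsto (2 * ·) (𝓝 t) (𝓝 s) := by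
    rintro t _ rfl
    exact (continuous_const_mul 2).tendsto t
  have right_tendsto : ∀ t s : ℝ, 2 * t - 1 = s → Filter.Tendsto (2 * · - 1) (𝓝 t) (𝓝 s) := by
    rintro t _ rfl
    exact ((continuous_const_mul 2).sub continuous_const).tendsto t
  have left_smooth : ContMDiff 𝓘(ℝ, ℝ) 𝓘(ℝ, ℝ) ∞ fun t : ℝ => 2 * t :=
    (contDiff_const.mul contDiff_id).contMDiff
  have right_smooth : ContMDiff 𝓘(ℝ, ℝ) 𝓘(ℝ, ℝ) ∞ fun t : ℝ => 2 * t - 1 :=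
    ((contDiff_const.mul contDiff_id).sub contDiff_const).contMDiff
  refine ⟨fun t => ?_, ?_, ?_⟩
  · rcases lt_trichotomy t (1 / 2) with ht | rfl | ht
    · refine ((h.smooth.comp left_smooth) t).congr_of_eventuallyEq ?_
      filter_upwards [Iio_mem_nhds ht] with s hs
      exact extend_left s hs.le
    · refine (contMDiffAt_const (c := y)).congr_of_eventuallyEq ?_
      filter_upwards [(left_tendsto (1 / 2) 1 (by norm_num)).eventually h.right,
        (right_tendsto (1 / 2) 0 (by norm_num)).eventually h'.left] with s hs hs'
      rcases le_total s (1 / 2) with hle | hle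
      · rw [extend_left s hle, hs]
      · rw [extend_right s hle, hs']
    · refine ((h'.smooth.comp right_smooth) t).congr_of_eventuallyEq ?_
      filter_upwards [Ioi_mem_nhds ht] with s hs
      exact extend_right s hs.le
  · filter_upwards [(left_tendsto 0 0 (by norm_num)).eventually h.left,
      Iio_mem_nhds (show (0 : ℝ) < 1 / 2 by norm_num)] with s hs hlt
    rw [extend_left s hlt.le, hs]
  · filter_upwards [(right_tendsto 1 1 (by norm_num)).eventually h'.right,
      Ioi_mem_nhds (show (1 / 2 : ℝ) < 1 by norm_num)] with s hs hlt
    rw [extend_right s hlt.le, hs]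

end IsFlatPath

variable [IsManifold (𝓡 n) ∞ M]

theorem exists_nhds_smooth_curve {W : Set M} (hW : W ∈ 𝓝 x) :
    ∃ V ∈ 𝓝 x, ∀ a ∈ V, ∀ b ∈ V, ∃ c : ℝ → M, ContMDiff 𝓘(ℝ, ℝ) (𝓡 n) ∞ c ∧
      (∀ t, c t ∈ W) ∧ (∀ t ≤ 1 / 3, c t = a) ∧ ∀ t, 2 / 3 ≤ t → c t = b := by
  let φ := extChartAt (𝓡 n) x
  obtain ⟨r, hr, hball⟩ : ∃ r > 0, Metric.ball (φ x) r ⊆ φ.target ∩ φ.symm ⁻¹' W := by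
    rw [← Metric.mem_nhds_iff]
    refine Filter.inter_mem (extChartAt_target_mem_nhds x)
      ((continuousAt_extChartAt_symm (I := 𝓡 n) x).preimage_mem_nhds ?_)
    rwa [extChartAt_to_inv]
  refine ⟨φ.source ∩ φ ⁻¹' Metric.ball (φ x) r,
    (isOpen_extChartAt_preimage' x Metric.isOpen_ball).mem_nhds
      ⟨mem_extChartAt_source x, Metric.mem_ball_self hr⟩, ?_⟩
  rintro a ⟨ha, ha_ball⟩ b ⟨hb, hb_ball⟩
  have mem_ball := flatSegment_mem (convex_ball (φ x) r) ha_ball hb_ball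
  refine ⟨fun t => φ.symm (flatSegment (φ a) (φ b) t), ?_, fun t => (hball (mem_ball t)).2,
    fun t ht => ?_, fun t ht => ?_⟩
  · exact (contMDiffOn_extChartAt_symm x).comp_contMDiff
      (contDiff_flatSegment _ _).contMDiff fun t => (hball (mem_ball t)).1
  · simp only [flatSegment_of_le _ _ ht, φ.left_inv ha]
  · simp only [flatSegment_of_ge _ _ ht, φ.left_inv hb]

variable {N : Type v} [TopologicalSpace N] {p : C(N, M)}

theorem exists_nhds_isFlatPath (hp : IsLocalHomeomorph p) (x : N) :
    ∃ V ∈ 𝓝 x, ∀ a ∈ V, ∀ b ∈ V, ∃ γ : Path a b, IsFlatPath n (γ.map p.continuous) := by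
  obtain ⟨e, hxe, he⟩ := hp x
  obtain ⟨V, hV, hcurve⟩ := exists_nhds_smooth_curve (n := n)
    (e.open_target.mem_nhds (he ▸ e.map_source hxe : p x ∈ e.target))
  refine ⟨e.source ∩ p ⁻¹' V, Filter.inter_mem (e.open_source.mem_nhds hxe)
    (p.continuous.continuousAt.preimage_mem_nhds hV), ?_⟩
  rintro a ⟨ha, haV⟩ b ⟨hb, hbV⟩
  obtain ⟨c, hc, mem_target, hc_left, hc_right⟩ := hcurve (p a) haV (p b) hbV
  let γ : Path a b :=
    { toFun := fun t => e.symm (c t)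
      continuous_toFun := e.continuousOn_symm.comp_continuous
        (hc.continuous.comp continuous_subtype_val) fun t => mem_target t
      source' := by rw [hc_left _ (by norm_num), he, e.left_inv ha]
      target' := by rw [hc_right _ (by norm_num), he, e.left_inv hb] }
  refine ⟨γ, IsFlatPath.of_curve hc hc_left hc_right fun t => ?_⟩
  change p (e.symm (c t)) = c t
  rw [he, e.right_inv (mem_target t)]

theorem exists_isFlatPath [ConnectedSpace N] (hp : IsLocalHomeomorph p) (x y : N) :
    ∃ γ : Path x y, IsFlatPath n (γ.map p.continuous) := by
  have concat : ∀ {a b c : N}, (∃ γ : Path a b, IsFlatPath n (γ.map p.continuous)) →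
      (∃ γ : Path b c, IsFlatPath n (γ.map p.continuous)) →
      ∃ γ : Path a c, IsFlatPath n (γ.map p.continuous) := by
    rintro a b c ⟨γ, hγ⟩ ⟨γ', hγ'⟩
    exact ⟨γ.trans γ', by simpa only [Path.map_trans] using hγ.trans hγ'⟩
  have isClopen_reachable : IsClopen {y | ∃ γ : Path x y, IsFlatPath n (γ.map p.continuous)} := by
    constructor
    · rw [← isOpen_compl_iff, isOpen_iff_mem_nhds]
      intro b hb
      obtain ⟨V, hV, hflat⟩ := exists_nhds_isFlatPath (n := n) hp b
      filter_upwards [hV] with c hc hxc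
      exact hb (concat hxc (hflat c hc b (mem_of_mem_nhds hV)))
    · rw [isOpen_iff_mem_nhds]
      intro b hb
      obtain ⟨V, hV, hflat⟩ := exists_nhds_isFlatPath (n := n) hp b
      filter_upwards [hV] with c hc
      exact concat hb (hflat b (mem_of_mem_nhds hV) c hc)
  have reachable_eq_univ := isClopen_reachable.eq_univ
    ⟨x, Path.refl x, IsFlatPath.refl (n := n) (p x)⟩
  exact Set.eq_univ_iff_forall.1 reachable_eq_univ y

end FlatPath

/-! ### The Abel-Jacobi map -/

theorem exists_path_lift {N M : Type*} [TopologicalSpace N] [TopologicalSpace M] {p : N → M}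
    (hp : IsCoveringMap p) (x : N) {m : M} (γ : Path (p x) m) :
    ∃ (y : N) (σ : Path x y), ∀ t, p (σ t) = γ t :=
  ⟨_, ⟨hp.liftPath γ x γ.source, hp.liftPath_zero γ x γ.source, rfl⟩,
    fun t => congr_fun (hp.liftPath_lifts γ x γ.source) t⟩

/-- The properties of the Abel-Jacobi map: it separates the points of a fibre, its differences on
a fibre are exactly the integer vectors, and it commutes with deck transformations up to
translations. -/
structure IsPeriodMap {N : Type v} {M : Type u} [TopologicalSpace N] [TopologicalSpace M] {b : ℕ}
    (p : C(N, M)) (j : C(N, Fin b → ℝ)) : Prop where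
  exists_int : ∀ x y, p x = p y → ∃ c : Fin b → ℤ, j y = j x + fun i => (c i : ℝ)
  exists_lift : ∀ x (c : Fin b → ℤ), ∃ y, p y = p x ∧ j y = j x + fun i => (c i : ℝ)
  inj : ∀ x y, p x = p y → j x = j y → x = y
  deck : ∀ δ : N ≃ₜ N, (∀ x, p (δ x) = p x) → ∀ x y, j (δ y) - j (δ x) = j y - j x

theorem repr_map_eq_mulVec {M : Type u} [TopologicalSpace M] {b : ℕ}
    (Γ : Module.Basis (Fin b) ℤ (H1 M)) (f : C(M, M)) (z : H1 M) :
    (fun i => (Γ.repr (H1.map f z) i : ℝ)) =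
      toRealMatrix (homologyMatrix Γ f) *ᵥ fun i => (Γ.repr z i : ℝ) := by
  ext i
  rw [← LinearMap.toMatrix_mulVec_repr Γ Γ (H1.map f) z]
  simp [homologyMatrix, toRealMatrix, Matrix.mulVec, dotProduct]

namespace PathCocycle

variable {M : Type u} [TopologicalSpace M] {N : Type v} [TopologicalSpace N] {b : ℕ}

/-- The periods of `c` over the loops of `M` are their homology coordinates in the basis `Γ`. -/
def IsDual (Γ : Module.Basis (Fin b) ℤ (H1 M)) (c : PathCocycle M (Fin b → ℝ)) : Prop :=
  ∀ ⦃x : M⦄ (γ : Path x x), c.along (.mk γ) = fun i => (Γ.repr (loopClass γ) i : ℝ)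

/-- The increments of `j` are the values of the pull-back of `c` under `p`. -/
def IsLiftedPrimitive {A : Type*} [AddCommGroup A] (c : PathCocycle M A) (p : C(N, M))
    (j : N → A) : Prop :=
  ∀ ⦃x y : N⦄ (γ : Path x y), c.along (.mk (γ.map p.continuous)) = j y - j x

theorem IsLiftedPrimitive.along_eq {A : Type*} [AddCommGroup A] {c : PathCocycle M A} {p : C(N, M)}
    {j : N → A} (hj : c.IsLiftedPrimitive p j) {x y : N} (γ : Path x y) {m m' : M}
    {σ : Path m m'} (h : ∀ t, p (γ t) = σ t) : c.along (.mk σ) = j y - j x := by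
  rw [← hj γ]
  exact c.along_congr fun t => (h t).symm

variable {Γ : Module.Basis (Fin b) ℤ (H1 M)} {c : PathCocycle M (Fin b → ℝ)} {p : C(N, M)}
  {j : N → Fin b → ℝ}

theorem IsLiftedPrimitive.sub_eq_repr (hj : c.IsLiftedPrimitive p j) (hc : c.IsDual Γ) {x y : N}
    (γ : Path x y) (h : p x = p y) :
    j y - j x = fun i => (Γ.repr (loopClass ((γ.map p.continuous).cast rfl h)) i : ℝ) :=
  (hj.along_eq γ fun _ => rfl).symm.trans (hc _)

variable [PathConnectedSpace N]

theorem IsLiftedPrimitive.isPeriodMap {j : C(N, Fin b → ℝ)} (hj : c.IsLiftedPrimitive p j)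
    (hc : c.IsDual Γ) (hp : IsUniversalAbelianCover p) [PathConnectedSpace M] :
    IsPeriodMap p j where
  exists_int x y h := ⟨_, sub_eq_iff_eq_add'.1
    (hj.sub_eq_repr hc (PathConnectedSpace.somePath x y) h)⟩
  exists_lift x v := by
    obtain ⟨γ, hγ⟩ := exists_loopClass_eq (p x) (Γ.equivFun.symm v)
    obtain ⟨y, τ, hτ⟩ := exists_path_lift hp.covering x γ
    refine ⟨y, by rw [← τ.target, hτ, γ.target], ?_⟩
    rw [← sub_eq_iff_eq_add', ← hj.along_eq τ hτ, hc, hγ]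
    ext i
    exact congr_arg (Int.cast (R := ℝ)) (congr_fun (Γ.equivFun.apply_symm_apply v) i)
  inj x y h hxy := by
    let γ := PathConnectedSpace.somePath x y
    have loopClass_eq_zero : loopClass ((γ.map p.continuous).cast rfl h) = 0 :=
      Γ.ext_elem fun i => by
        have repr_eq := congr_fun (hj.sub_eq_repr hc γ h) i
        rw [hxy, sub_self, Pi.zero_apply] at repr_eq
        simpa using repr_eq.symm
    refine hp.eq_of_edgeClass_map h (γ := γ) ?_
    rw [← edgeClass_cast (γ.map p.continuous) rfl h, ← toEdgeClasses_loopClass, loopClass_eq_zero,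
      map_zero]
  deck δ hδ x y := by
    let γ := PathConnectedSpace.somePath x y
    rw [← hj γ]
    exact (hj.along_eq (γ.map δ.continuous) (σ := γ.map p.continuous) fun t => hδ (γ t)).symm

theorem IsLiftedPrimitive.map_sub_map_eq_mulVec (hj : c.IsLiftedPrimitive p j) (hc : c.IsDual Γ)
    {f : C(M, M)} {F : C(N, N)} (hF : ∀ x, p (F x) = f (p x)) {x y : N} (h : p x = p y) :
    j (F y) - j (F x) = toRealMatrix (homologyMatrix Γ f) *ᵥ (j y - j x) := by
  let γ := PathConnectedSpace.somePath x y
  let σ : Path (p x) (p x) := (γ.map p.continuous).cast rfl h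
  rw [← hj.along_eq (γ.map F.continuous) (σ := σ.map f.continuous) fun t => hF (γ t),
    hj.sub_eq_repr hc γ h, hc, ← H1.map_loopClass, repr_map_eq_mulVec]

end PathCocycle

section Forms

variable {n b : ℕ} {M : Type u} [TopologicalSpace M] [ChartedSpace (EuclideanSpace ℝ (Fin n)) M]
  {N : Type v} [TopologicalSpace N] {p : C(N, M)}

theorem LocalPrimitives.integral_apply_eq_lineIntegral {ι : Type*} {η : ι → CovectorField n M}
    {S : LocalPrimitives M M (ι → ℝ)}
    (hS : ∀ x i, IsPrimitiveOn (η i) (fun y => S.fn x y i) (S.dom x)) {x y : M} {γ : Path x y}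
    (hγ : IsSmoothPath (n := n) γ) (i : ι) : S.integral.along (.mk γ) i = lineIntegral (η i) γ := by
  have : ContractibleSpace unitInterval :=
    (convex_Icc (0 : ℝ) 1).contractibleSpace ⟨0, unitInterval.zero_mem⟩
  have : LocallyPathConnectedSpace unitInterval := (convex_Icc (0 : ℝ) 1).locallyPathConnectedSpace
  obtain ⟨g, -, hg⟩ := S.exists_primitiveAlong (p := (γ : C(unitInterval, M))) (x₀ := 0) <| by
    rintro _ ⟨α, rfl⟩
    rw [Subsingleton.elim α 1, map_one]
    exact one_mem _
  rw [S.integral_along hg, lineIntegral_eq_sub hS hγ hg, Pi.sub_apply]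

theorem locallyPathConnectedSpace_of_isLocalHomeomorph {X Y : Type*} [TopologicalSpace X]
    [TopologicalSpace Y] [LocallyPathConnectedSpace Y] {f : X → Y} (hf : IsLocalHomeomorph f) :
    LocallyPathConnectedSpace X := by
  let : ChartedSpace Y X :=
    { atlas := Set.univ
      chartAt := fun x => (hf x).choose
      mem_chart_source := fun x => (hf x).choose_spec.1
      chart_mem_atlas := fun x => Set.mem_univ _ }
  exact ChartedSpace.locallyPathConnectedSpace Y X

variable [IsManifold (𝓡 n) ∞ M]

theorem IsUniversalAbelianCover.exists_isSmoothPath_loopClass_eq (hp : IsUniversalAbelianCover p)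
    (x : N) (γ : Path (p x) (p x)) :
    ∃ σ : Path (p x) (p x), IsSmoothPath (n := n) σ ∧ loopClass σ = loopClass γ := by
  have := hp.connected
  obtain ⟨y, τ, hτ⟩ := exists_path_lift hp.covering x γ
  obtain ⟨σ, hσ⟩ := exists_isFlatPath (n := n) hp.covering.isLocalHomeomorph x y
  have hy : p x = p y := by rw [← τ.target, hτ, γ.target]
  refine ⟨(σ.map p.continuous).cast rfl hy, hσ.isSmoothPath, loopClass_eq_of_edgeClass_eq ?_⟩
  calc edgeClass ((σ.map p.continuous).cast rfl hy) = edgeClass (σ.map p.continuous) :=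
        edgeClass_cast _ _ _
    _ = edgeClass (τ.map p.continuous) := hp.along_map_eq (edgeCocycle M) σ τ
    _ = edgeClass γ := (edgeCocycle M).along_congr hτ

theorem IsDualFamily.isDual_integral [PathConnectedSpace M] {Γ : Module.Basis (Fin b) ℤ (H1 M)}
    {η : Fin b → CovectorField n M} (hη : IsDualFamily Γ η) {S : LocalPrimitives M M (Fin b → ℝ)}
    (hS : ∀ x i, IsPrimitiveOn (η i) (fun y => S.fn x y i) (S.dom x))
    (hp : IsUniversalAbelianCover p) : S.integral.IsDual Γ := by
  intro x γ
  have := hp.connected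
  obtain ⟨x₀⟩ : Nonempty N := inferInstance
  have along_basis (k : Fin b) (γ : Path (p x₀) (p x₀)) (hγ : loopClass γ = Γ k) :
      S.integral.along (.mk γ) = Pi.single k 1 := by
    obtain ⟨σ, hσ, σ_class⟩ := hp.exists_isSmoothPath_loopClass_eq (n := n) x₀ γ
    ext i
    rw [← S.integral.along_eq_of_loopClass_eq σ_class, S.integral_apply_eq_lineIntegral hS hσ,
      hη.dual i k _ σ hσ (σ_class.trans hγ), Pi.single_apply]
  rw [S.integral.along_eq_sum_repr Γ (p x₀) along_basis γ]
  ext i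
  simp [Pi.single_apply]

theorem LocalPrimitives.IsPrimitiveAlong.isLiftedPrimitive {V : Type*} [TopologicalSpace V]
    [AddCommGroup V] [IsTopologicalAddGroup V] {ι : Type*} {S : LocalPrimitives ι M V} {j : N → V}
    (hj : S.IsPrimitiveAlong p j) : S.integral.IsLiftedPrimitive p j := fun _ _ γ => by
  rw [S.integral_along (γ := γ.map p.continuous) (hj.comp γ.continuous), Function.comp_apply,
    Function.comp_apply, γ.source, γ.target]

theorem abelJacobi_eq_of_isPrimitiveAlong {η : Fin b → CovectorField n M}
    {S : LocalPrimitives M M (Fin b → ℝ)}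
    (hS : ∀ x i, IsPrimitiveOn (η i) (fun y => S.fn x y i) (S.dom x))
    [ConnectedSpace N] (hp : IsLocalHomeomorph p) {x₀ : N} {j : N → Fin b → ℝ}
    (hj : S.IsPrimitiveAlong p j) (hj₀ : j x₀ = 0) : abelJacobi p η x₀ = j := by
  ext x i
  obtain ⟨γ, hγ⟩ := exists_isFlatPath (n := n) hp x₀ x
  have hex : ∃ γ : Path x₀ x, IsSmoothPath (n := n) (γ.map p.continuous) := ⟨γ, hγ.isSmoothPath⟩
  rw [abelJacobi, dif_pos hex, ← S.integral_apply_eq_lineIntegral hS hex.choose_spec,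
    hj.isLiftedPrimitive, hj₀, sub_zero]

theorem exists_periodMap [ConnectedSpace M] (hp : IsUniversalAbelianCover p)
    (Γ : Module.Basis (Fin b) ℤ (H1 M)) {η : Fin b → CovectorField n M}
    (hη : IsDualFamily Γ η) (x₀ : N) :
    ∃ j : C(N, Fin b → ℝ), abelJacobi p η x₀ = j ∧ IsPeriodMap p j ∧
      ∀ (f : C(M, M)) (F : C(N, N)), (∀ x, p (F x) = f (p x)) → ∀ x y, p x = p y →
        j (F y) - j (F x) = toRealMatrix (homologyMatrix Γ f) *ᵥ (j y - j x) := by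
  have hloc := hp.covering.isLocalHomeomorph
  have := hp.connected
  have : LocallyPathConnectedSpace M :=
    ChartedSpace.locallyPathConnectedSpace (EuclideanSpace ℝ (Fin n)) M
  have : LocallyPathConnectedSpace N := locallyPathConnectedSpace_of_isLocalHomeomorph hloc
  have : PathConnectedSpace N := pathConnectedSpace_iff_connectedSpace.2 inferInstance
  have : PathConnectedSpace M := pathConnectedSpace_iff_connectedSpace.2 inferInstance
  obtain ⟨S, hS⟩ := exists_localPrimitives hη.closed
  obtain ⟨j, hj₀, hj⟩ := S.exists_primitiveAlong (hp.range_map x₀).le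
  have hdual := hη.isDual_integral hS hp
  have hlift := hj.isLiftedPrimitive
  exact ⟨⟨j, hj.continuous p.continuous⟩, abelJacobi_eq_of_isPrimitiveAlong hS hloc hj hj₀,
    hlift.isPeriodMap hdual hp, fun _ _ hF _ _ h => hlift.map_sub_map_eq_mulVec hdual hF h⟩

end Forms

/-! ### Hyperbolic elements of a Banach algebra -/

section BanachAlgebra

open Polynomial

variable {A : Type*} [NormedRing A] [NormedAlgebra ℂ A] {T B : A}

/-- `B` inverts `T` on its unstable subspace and vanishes on its stable subspace: `T * B` is the
projection onto the former along the latter. In this form, a hyperbolic `T` need not be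
invertible. -/
structure IsUnstableInverse (T B : A) : Prop where
  commute : Commute T B
  mul_mul : B * T * B = B
  spectralRadius_lt : spectralRadius ℂ B < 1
  spectralRadius_stable_lt : spectralRadius ℂ (T * (1 - T * B)) < 1

namespace IsUnstableInverse

theorem mul_mul_cancel (hB : IsUnstableInverse T B) : T * B * B = B := by
  rw [hB.commute.eq, hB.mul_mul]

theorem stable_mul_stable (hB : IsUnstableInverse T B) :
    (1 - T * B) * (1 - T * B) = 1 - T * B := by
  have projection_mul : T * B * (T * B) = T * B := by
    rw [mul_assoc T, ← mul_assoc B, hB.mul_mul]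
  rw [mul_sub, mul_one, sub_mul, one_mul, projection_mul, sub_self, sub_zero]

theorem stable_commute (hB : IsUnstableInverse T B) : T * (1 - T * B) = (1 - T * B) * T :=
  (Commute.one_right T).sub_right ((Commute.refl T).mul_right hB.commute)

theorem mul_unstable_mul (hB : IsUnstableInverse T B) : B * (T * B) * T = T * B := by
  rw [← mul_assoc, hB.mul_mul, hB.commute.eq]

theorem mul_stable_mul_stable (hB : IsUnstableInverse T B) :
    T * ((1 - T * B) * (1 - T * B)) = (1 - T * B) * T := by
  rw [hB.stable_mul_stable, hB.stable_commute]

end IsUnstableInverse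

theorem eval_minpoly_of_mem_spectrum {μ : ℂ} (hμ : μ ∈ spectrum ℂ T) :
    (minpoly ℂ T).eval μ = 0 := by
  rcases subsingleton_or_nontrivial A with _ | _
  · simp at hμ
  · simpa using spectrum.subset_polynomial_aeval T (minpoly ℂ T) ⟨μ, hμ, rfl⟩

variable [CompleteSpace A]

theorem spectralRadius_lt_one (h : ∀ μ ∈ spectrum ℂ T, ‖μ‖ < 1) : spectralRadius ℂ T < 1 := by
  rcases subsingleton_or_nontrivial A with _ | _
  · rw [spectrum.SpectralRadius.of_subsingleton]
    exact one_pos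
  · exact spectrum.spectralRadius_lt_of_forall_lt T (r := 1) h

theorem exists_norm_pow_le_of_spectralRadius_lt_one (h : spectralRadius ℂ T < 1) :
    ∃ r : ℝ, 0 < r ∧ r < 1 ∧ ∃ C : ℝ, 0 < C ∧ ∀ k : ℕ, ‖T ^ k‖ ≤ C * r ^ k := by
  obtain ⟨r, hTr, hr⟩ := ENNReal.lt_iff_exists_nnreal_btwn.1 h
  have r_pos : 0 < (r : ℝ) := by exact_mod_cast (zero_le (a := spectralRadius ℂ T)).trans_lt hTr
  have isBigO : (fun k : ℕ => T ^ k) =O[Filter.atTop] fun k : ℕ => (r : ℝ) ^ k := by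
    refine Asymptotics.IsBigO.of_bound 1 ?_
    filter_upwards [(spectrum.pow_norm_pow_one_div_tendsto_nhds_spectralRadius
      T).eventually_lt_const hTr, Filter.eventually_gt_atTop 0] with k hk k_pos
    rw [← ENNReal.ofReal_coe_nnreal] at hk
    have root_lt : ‖T ^ k‖ ^ (1 / k : ℝ) < r := (ENNReal.ofReal_lt_ofReal_iff r_pos).1 hk
    rw [one_mul, Real.norm_of_nonneg (pow_nonneg r.coe_nonneg k)]
    calc ‖T ^ k‖ = (‖T ^ k‖ ^ (1 / k : ℝ)) ^ k := by
          rw [one_div, Real.rpow_inv_natCast_pow (norm_nonneg _) k_pos.ne']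
      _ ≤ (r : ℝ) ^ k := by gcongr
  obtain ⟨C, C_pos, hC⟩ := Asymptotics.bound_of_isBigO_nat_atTop isBigO
  refine ⟨r, r_pos, by exact_mod_cast hr, C, C_pos, fun k => ?_⟩
  simpa using hC (pow_ne_zero k r_pos.ne')

theorem exists_eval_eq_of_mem_spectrum_aeval {q : ℂ[X]} {μ : ℂ}
    (hμ : μ ∈ spectrum ℂ (aeval T q)) : ∃ ν ∈ spectrum ℂ T, q.eval ν = μ := by
  rcases subsingleton_or_nontrivial A with _ | _
  · simp at hμ
  · rwa [spectrum.map_polynomial_aeval] at hμ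

theorem exists_eq_mul_of_dichotomy {q : ℂ[X]} (hq : q.Monic) (S : Set ℂ) :
    ∃ u s : ℂ[X], q = u * s ∧ (∀ μ, u.eval μ = 0 → μ ∈ S) ∧ ∀ μ, s.eval μ = 0 → μ ∉ S := by
  classical
  have mem_of_eval {R : Multiset ℂ} {μ : ℂ} (h : (R.map fun a => X - C a).prod.eval μ = 0) :
      μ ∈ R := by
    rw [eval_multiset_prod, Multiset.prod_eq_zero_iff, Multiset.map_map, Multiset.mem_map] at h
    obtain ⟨a, ha, hμ⟩ := h
    rw [Function.comp_apply, eval_sub, eval_X, eval_C, sub_eq_zero] at hμ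
    exact hμ ▸ ha
  refine ⟨((q.roots.filter (· ∈ S)).map fun a => X - C a).prod,
    ((q.roots.filter (· ∉ S)).map fun a => X - C a).prod, ?_,
    fun μ h => (Multiset.mem_filter.1 (mem_of_eval h)).2,
    fun μ h => (Multiset.mem_filter.1 (mem_of_eval h)).2⟩
  rw [← Multiset.prod_add, ← Multiset.map_add, Multiset.filter_add_not]
  exact (IsAlgClosed.splits q).eq_prod_roots_of_monic hq

theorem exists_isUnstableInverse_of_one_lt (h : ∀ μ ∈ spectrum ℂ T, 1 < ‖μ‖) :
    ∃ B, IsUnstableInverse T B ∧ T * B = 1 := by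
  obtain ⟨T, rfl⟩ : IsUnit T := spectrum.isUnit_of_zero_notMem ℂ fun h₀ => by
    simpa [zero_le_one.not_gt] using h 0 h₀
  refine ⟨↑T⁻¹, ⟨by simp [Commute, SemiconjBy], by simp, spectralRadius_lt_one fun μ hμ => ?_,
    by simp⟩, T.mul_inv⟩
  rw [← spectrum.map_inv, Set.mem_inv] at hμ
  have := h _ hμ
  rw [norm_inv] at this
  exact (one_lt_inv_iff₀.1 this).2

theorem isUnstableInverse_aeval {β : ℂ[X]} (hβ : aeval T (β * (X * β - 1)) = 0)
    (h : ∀ μ ∈ spectrum ℂ T, ‖β.eval μ‖ < 1)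
    (h_stable : ∀ μ ∈ spectrum ℂ T, ‖μ * (1 - μ * β.eval μ)‖ < 1) :
    IsUnstableInverse T (aeval T β) where
  commute := by simpa using (Commute.all X β).map (aeval T)
  mul_mul := by
    rw [map_mul, map_sub, map_mul, map_one, aeval_X, mul_sub, mul_one, sub_eq_zero] at hβ
    rw [mul_assoc, hβ]
  spectralRadius_lt := spectralRadius_lt_one fun μ hμ => by
    obtain ⟨ν, hν, rfl⟩ := exists_eval_eq_of_mem_spectrum_aeval hμ
    exact h ν hν
  spectralRadius_stable_lt := spectralRadius_lt_one fun μ hμ => by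
    have stable_eq : T * (1 - T * aeval T β) = aeval T (X * (1 - X * β)) := by simp
    rw [stable_eq] at hμ
    obtain ⟨ν, hν, rfl⟩ := exists_eval_eq_of_mem_spectrum_aeval hμ
    simpa using h_stable ν hν

/- The polynomial `β` vanishes on the stable part of the spectrum and is `μ⁻¹` on the unstable
part. -/
theorem exists_isUnstableInverse (hT : IsIntegral ℂ T) (h : ∀ μ ∈ spectrum ℂ T, ‖μ‖ ≠ 1) :
    ∃ B, IsUnstableInverse T B := by
  obtain ⟨u, s, hus, hu, hs⟩ := exists_eq_mul_of_dichotomy (minpoly.monic hT) {μ | 1 < ‖μ‖}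
  have isCoprime : IsCoprime u (X * s) := by
    rw [isCoprime_iff_aeval_ne_zero_of_isAlgClosed ℂ ℂ]
    intro μ
    by_contra! hμ
    simp only [coe_aeval_eq_eval, eval_mul, eval_X, mul_eq_zero] at hμ
    obtain ⟨hμu, rfl | hμs⟩ := hμ
    · simpa [zero_le_one.not_gt] using hu 0 hμu
    · exact hs μ hμs (hu μ hμu)
  obtain ⟨a, c, hac⟩ := isCoprime
  have eval_dichotomy : ∀ μ ∈ spectrum ℂ T,
      1 < ‖μ‖ ∧ μ * (c * s).eval μ = 1 ∨ ‖μ‖ < 1 ∧ (c * s).eval μ = 0 := fun μ hμ => by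
    have minpoly_eval := eval_minpoly_of_mem_spectrum hμ
    rw [hus, eval_mul, mul_eq_zero] at minpoly_eval
    refine minpoly_eval.imp (fun hμu => ⟨hu μ hμu, ?_⟩) fun hμs =>
      ⟨(not_lt.1 (hs μ hμs)).lt_of_ne (h μ hμ), by simp [hμs]⟩
    have hac_eval := congrArg (eval μ) hac
    simp only [eval_add, eval_mul, eval_X, eval_one] at hac_eval ⊢
    linear_combination hac_eval - a.eval μ * hμu
  refine ⟨aeval T (c * s), isUnstableInverse_aeval ?_ (fun μ hμ => ?_) fun μ hμ => ?_⟩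
  · have minpoly_dvd : c * s * (X * (c * s) - 1) = -(c * a) * minpoly ℂ T := by
      rw [hus]
      linear_combination c * s * hac
    rw [minpoly_dvd, map_mul, minpoly.aeval, mul_zero]
  · obtain ⟨hμ₁, hβ⟩ | ⟨-, hβ⟩ := eval_dichotomy μ hμ
    · rw [eq_inv_of_mul_eq_one_right hβ, norm_inv]
      exact inv_lt_one_of_one_lt₀ hμ₁
    · simp [hβ]
  · obtain ⟨-, hβ⟩ | ⟨hμ₁, hβ⟩ := eval_dichotomy μ hμ
    · simp only [hβ, sub_self, mul_zero, norm_zero, zero_lt_one]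
    · simpa only [hβ, mul_zero, sub_zero, mul_one] using hμ₁

end BanachAlgebra

section BanachSpace

variable {E : Type*} [NormedAddCommGroup E] [NormedSpace ℂ E] [CompleteSpace E]

/- The seminorm is `w ↦ ⨆ k, r⁻¹ ^ k * ‖S ^ k w‖`, for `r < 1` above the spectral radius. -/
theorem exists_contracted_seminorm {S : E →L[ℂ] E} (hS : spectralRadius ℂ S < 1) :
    ∃ (L : AddGroupSeminorm E) (lam C : ℝ), 1 < lam ∧ 0 < C ∧ (∀ w, ‖w‖ ≤ L w) ∧
      (∀ w, L w ≤ C * ‖w‖) ∧ ∀ w, lam * L (S w) ≤ L w := by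
  obtain ⟨r, r_pos, r_lt_one, C, C_pos, norm_pow_le⟩ :=
    exists_norm_pow_le_of_spectralRadius_lt_one hS
  have term_le (w : E) (k : ℕ) : r⁻¹ ^ k * ‖(S ^ k) w‖ ≤ C * ‖w‖ :=
    calc r⁻¹ ^ k * ‖(S ^ k) w‖ ≤ r⁻¹ ^ k * (C * r ^ k * ‖w‖) := by
          gcongr
          exact (S ^ k).le_of_opNorm_le (norm_pow_le k) w
      _ = (r⁻¹ * r) ^ k * (C * ‖w‖) := by ring
      _ = C * ‖w‖ := by rw [inv_mul_cancel₀ r_pos.ne', one_pow, one_mul]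
  have bddAbove (w : E) : BddAbove (Set.range fun k : ℕ => r⁻¹ ^ k * ‖(S ^ k) w‖) :=
    ⟨C * ‖w‖, Set.forall_mem_range.2 (term_le w)⟩
  let L : AddGroupSeminorm E :=
    { toFun := fun w => ⨆ k : ℕ, r⁻¹ ^ k * ‖(S ^ k) w‖
      map_zero' := by simp
      add_le' := fun w w' => ciSup_le fun k =>
        calc r⁻¹ ^ k * ‖(S ^ k) (w + w')‖
            ≤ r⁻¹ ^ k * ‖(S ^ k) w‖ + r⁻¹ ^ k * ‖(S ^ k) w'‖ := by
              rw [map_add, ← mul_add]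
              gcongr
              exact norm_add_le _ _
          _ ≤ _ := add_le_add (le_ciSup (bddAbove w) k) (le_ciSup (bddAbove w') k)
      neg' := fun w => by simp }
  refine ⟨L, r⁻¹, C, (one_lt_inv₀ r_pos).2 r_lt_one, C_pos, fun w => ?_,
    fun w => ciSup_le (term_le w), fun w => ?_⟩
  · exact Eq.trans_le (by simp) (le_ciSup (bddAbove w) 0)
  · change r⁻¹ * (⨆ k : ℕ, r⁻¹ ^ k * ‖(S ^ k) (S w)‖) ≤ ⨆ k : ℕ, r⁻¹ ^ k * ‖(S ^ k) w‖
    rw [Real.mul_iSup_of_nonneg (inv_nonneg.2 r_pos.le)]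
    refine ciSup_le fun k => Eq.trans_le ?_ (le_ciSup (bddAbove w) (k + 1))
    rw [pow_succ S, mul_apply_eq_comp, pow_succ', mul_assoc]

/- The solution is the series `∑ k, S ^ k ∘ g ∘ f^[k]`. -/
theorem exists_eq_add_comp {M : Type*} [TopologicalSpace M] [CompactSpace M] {S : E →L[ℂ] E}
    (hS : spectralRadius ℂ S < 1) (f : C(M, M)) (g : C(M, E)) :
    ∃ φ : C(M, E), ∀ m, φ m = g m + S (φ (f m)) := by
  obtain ⟨r, r_pos, r_lt_one, C, -, norm_pow_le⟩ :=
    exists_norm_pow_le_of_spectralRadius_lt_one hS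
  let term (k : ℕ) (m : M) : E := (S ^ k) (g (f^[k] m))
  have continuous_term (k : ℕ) : Continuous (term k) :=
    (S ^ k).continuous.comp (g.continuous.comp (f.continuous.iterate k))
  have norm_term_le (k : ℕ) (m : M) : ‖term k m‖ ≤ C * r ^ k * ‖g‖ :=
    (S ^ k).le_of_opNorm_le_of_le (norm_pow_le k) (g.norm_coe_le_norm _)
  have summable_bound : Summable fun k : ℕ => C * r ^ k * ‖g‖ :=
    ((summable_geometric_of_lt_one r_pos.le r_lt_one).mul_left C).mul_right _
  have summable_term (m : M) : Summable fun k => term k m :=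
    .of_norm_bounded summable_bound fun k => norm_term_le k m
  refine ⟨⟨fun m => ∑' k, term k m, continuous_tsum continuous_term summable_bound norm_term_le⟩,
    fun m => ?_⟩
  change ∑' k, term k m = g m + S (∑' k, term k (f m))
  rw [(summable_term m).tsum_eq_zero_add, S.map_tsum (summable_term (f m))]
  refine congrArg₂ (· + ·) rfl (tsum_congr fun k => ?_)
  simp only [term, pow_succ', mul_apply_eq_comp, Function.iterate_succ_apply]

namespace IsUnstableInverse

variable {M : Type*} [TopologicalSpace M] [CompactSpace M] {T B : E →L[ℂ] E}

theorem exists_map_eq_add_of_mul_eq_one (hB : IsUnstableInverse T B) (hTB : T * B = 1)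
    (f : C(M, M)) (g : C(M, E)) : ∃ φ : C(M, E), ∀ m, T (φ m) = φ (f m) + g m := by
  obtain ⟨φ, hφ⟩ := exists_eq_add_comp hB.spectralRadius_lt f ((B : C(E, E)).comp g)
  refine ⟨φ, fun m => ?_⟩
  have map_B (w : E) : T (B w) = w := DFunLike.congr_fun hTB w
  rw [hφ m, map_add, map_B]
  exact (congrArg (· + φ (f m)) (map_B (g m))).trans (add_comm _ _)

/- The stable part of the equation is solved along the orbits of `h⁻¹`. -/
theorem exists_map_eq_add (hB : IsUnstableInverse T B) (h : M ≃ₜ M) (g : C(M, E)) :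
    ∃ φ : C(M, E), ∀ m, T (φ m) = φ (h m) + g m := by
  let Q : E →L[ℂ] E := 1 - T * B
  obtain ⟨φ, hφ⟩ := exists_eq_add_comp hB.spectralRadius_lt h ((B : C(E, E)).comp g)
  obtain ⟨χ, hχ⟩ := exists_eq_add_comp hB.spectralRadius_stable_lt (h.symm : C(M, M))
    (-(Q : C(E, E)).comp (g.comp (h.symm : C(M, M))))
  have projection_φ (m : M) : T (B (φ m)) = φ m := by
    have φ_eq : φ m = B (g m + φ (h m)) := (hφ m).trans (map_add B _ _).symm
    rw [φ_eq]
    exact DFunLike.congr_fun hB.mul_mul_cancel _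
  have stable_χ (m : M) : Q (χ m) = χ m := by
    have χ_eq : χ m = Q (-g (h.symm m) + T (χ (h.symm m))) := by
      rw [map_add, map_neg]
      refine (hχ m).trans (congrArg _ ?_)
      exact DFunLike.congr_fun hB.stable_commute _
    rw [χ_eq]
    exact DFunLike.congr_fun hB.stable_mul_stable _
  have map_φ (m : M) : T (φ m) = T (B (g m)) + φ (h m) := by
    rw [hφ m, map_add, projection_φ]
    rfl
  have map_χ (m : M) : T (χ m) = χ (h m) + Q (g m) := by
    have χ_eq : χ (h m) = -Q (g (h.symm (h m))) + T (Q (χ (h.symm (h m)))) := hχ (h m)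
    rw [χ_eq, h.symm_apply_apply, stable_χ]
    abel
  refine ⟨φ + χ, fun m => ?_⟩
  have split_g : g m = T (B (g m)) + Q (g m) := (add_sub_cancel _ _).symm
  rw [ContinuousMap.add_apply, ContinuousMap.add_apply, map_add, map_φ, map_χ]
  nth_rw 3 [split_g]
  abel

end IsUnstableInverse

end BanachSpace

theorem nonpos_of_mul_le_succ_of_bounded {a : ℕ → ℝ} {lam K : ℝ} (hlam : 1 < lam)
    (h : ∀ k, lam * a k ≤ a (k + 1)) (hK : ∀ k, a k ≤ K) : a 0 ≤ 0 := by
  by_contra! a_pos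
  obtain ⟨k, hk⟩ := ((tendsto_atTop_of_geom_le a_pos hlam h).eventually_gt_atTop K).exists
  exact (hK k).not_gt hk

section AdaptedPair

/-- The seminorms `L₁` and `L₂` are adapted to the map `T`, which expands the first and contracts
the second by the factor `lam`; their sum is equivalent to the norm. -/
structure IsAdaptedPair {E : Type*} [SeminormedAddCommGroup E] (T : E → E)
    (L₁ L₂ : AddGroupSeminorm E) (lam C : ℝ) : Prop where
  one_lt : 1 < lam
  pos : 0 < C
  norm_le : ∀ v, ‖v‖ ≤ L₁ v + L₂ v
  le_norm₁ : ∀ v, L₁ v ≤ C * ‖v‖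
  le_norm₂ : ∀ v, L₂ v ≤ C * ‖v‖
  expanding : ∀ v, lam * L₁ v ≤ L₁ (T v)
  contracting : ∀ v, lam * L₂ (T v) ≤ L₂ v

theorem seminorm_map_le {E : Type*} [SeminormedAddCommGroup E] [NormedSpace ℂ E]
    {L : AddGroupSeminorm E} {c : ℝ} (hc : 0 ≤ c) (hL : ∀ w, L w ≤ c * ‖w‖)
    (R : E →L[ℂ] E) (v : E) : L (R v) ≤ c * ‖R‖ * ‖v‖ := by
  rw [mul_assoc]
  exact (hL _).trans (mul_le_mul_of_nonneg_left (R.le_opNorm v) hc)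

theorem IsUnstableInverse.exists_isAdaptedPair {E : Type*} [NormedAddCommGroup E]
    [NormedSpace ℂ E] [CompleteSpace E] {T B : E →L[ℂ] E} (hB : IsUnstableInverse T B) :
    ∃ (L₁ L₂ : AddGroupSeminorm E) (lam C : ℝ), IsAdaptedPair T L₁ L₂ lam C ∧
      (T * B = 1 → L₂ = 0) := by
  obtain ⟨L₁, lam₁, C₁, hlam₁, hC₁, norm_le₁, le_norm₁, hL₁⟩ :=
    exists_contracted_seminorm hB.spectralRadius_lt
  obtain ⟨L₂, lam₂, C₂, hlam₂, hC₂, norm_le₂, le_norm₂, hL₂⟩ :=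
    exists_contracted_seminorm hB.spectralRadius_stable_lt
  let P : E →L[ℂ] E := T * B
  let Q : E →L[ℂ] E := 1 - T * B
  have B_P_T (v : E) : B (P (T v)) = P v := DFunLike.congr_fun hB.mul_unstable_mul v
  have T_Q_Q (v : E) : T (Q (Q v)) = Q (T v) := DFunLike.congr_fun hB.mul_stable_mul_stable v
  refine ⟨L₁.comp P.toAddMonoidHom, L₂.comp Q.toAddMonoidHom, min lam₁ lam₂,
    C₁ * ‖P‖ + C₂ * ‖Q‖ + 1, ⟨lt_min hlam₁ hlam₂, by positivity, fun v => ?_, fun v => ?_,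
      fun v => ?_, fun v => ?_, fun v => ?_⟩, fun hTB => ?_⟩
  · calc ‖v‖ = ‖P v + Q v‖ := congrArg norm (add_sub_cancel (P v) v).symm
      _ ≤ ‖P v‖ + ‖Q v‖ := norm_add_le _ _
      _ ≤ L₁ (P v) + L₂ (Q v) := add_le_add (norm_le₁ _) (norm_le₂ _)
  · refine (seminorm_map_le hC₁.le le_norm₁ P v).trans ?_
    gcongr
    linarith [mul_nonneg hC₂.le (norm_nonneg Q)]
  · refine (seminorm_map_le hC₂.le le_norm₂ Q v).trans ?_
    gcongr
    linarith [mul_nonneg hC₁.le (norm_nonneg P)]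
  · calc min lam₁ lam₂ * L₁ (P v) ≤ lam₁ * L₁ (B (P (T v))) := by
          rw [B_P_T]
          gcongr
          exact min_le_left _ _
      _ ≤ L₁ (P (T v)) := hL₁ _
  · calc min lam₁ lam₂ * L₂ (Q (T v)) ≤ lam₂ * L₂ (T (Q (Q v))) := by
          rw [T_Q_Q]
          gcongr
          exact min_le_right _ _
      _ ≤ L₂ (Q v) := hL₂ _
  · ext v
    have Q_eq_zero : Q = 0 := sub_eq_zero.2 hTB.symm
    simp [Q_eq_zero]

namespace IsAdaptedPair

variable {E F : Type*} [NormedAddCommGroup E] [SeminormedAddCommGroup F] {T : E → E}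
  {L₁ L₂ L : AddGroupSeminorm E} {lam C K : ℝ}

theorem comp {T' : F → F} (hT : IsAdaptedPair T L₁ L₂ lam C) (ι : F →+ E)
    (norm_ι : ∀ v, ‖ι v‖ = ‖v‖) (ι_comm : ∀ v, ι (T' v) = T (ι v)) :
    IsAdaptedPair T' (L₁.comp ι) (L₂.comp ι) lam C where
  one_lt := hT.one_lt
  pos := hT.pos
  norm_le v := norm_ι v ▸ hT.norm_le (ι v)
  le_norm₁ v := norm_ι v ▸ hT.le_norm₁ (ι v)
  le_norm₂ v := norm_ι v ▸ hT.le_norm₂ (ι v)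
  expanding v := by simpa only [AddGroupSeminorm.comp_apply, ι_comm] using hT.expanding (ι v)
  contracting v := by simpa only [AddGroupSeminorm.comp_apply, ι_comm] using hT.contracting (ι v)

theorem seminorm₁_eq_zero (hT : IsAdaptedPair T L₁ L₂ lam C) {v : ℕ → E}
    (hv : ∀ k, v (k + 1) = T (v k)) (hK : ∀ k, ‖v k‖ ≤ K) : L₁ (v 0) = 0 := by
  refine (nonpos_of_mul_le_succ_of_bounded (a := fun k => L₁ (v k)) (K := C * K) hT.one_lt
    (fun k => ?_) fun k => ?_).antisymm (apply_nonneg L₁ _)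
  · rw [hv]
    exact hT.expanding _
  · exact (hT.le_norm₁ _).trans (mul_le_mul_of_nonneg_left (hK k) hT.pos.le)

theorem seminorm₂_eq_zero (hT : IsAdaptedPair T L₁ L₂ lam C) {v : ℕ → E}
    (hv : ∀ k, v k = T (v (k + 1))) (hK : ∀ k, ‖v k‖ ≤ K) : L₂ (v 0) = 0 := by
  refine (nonpos_of_mul_le_succ_of_bounded (a := fun k => L₂ (v k)) (K := C * K) hT.one_lt
    (fun k => ?_) fun k => ?_).antisymm (apply_nonneg L₂ _)
  · rw [hv]
    exact hT.contracting _
  · exact (hT.le_norm₂ _).trans (mul_le_mul_of_nonneg_left (hK k) hT.pos.le)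

theorem eq_zero_of_bounded (hT : IsAdaptedPair T L₁ L₂ lam C) {v : ℤ → E}
    (hv : ∀ i, v (i + 1) = T (v i)) (hK : ∀ i, ‖v i‖ ≤ K) : v 0 = 0 := by
  have forward : L₁ (v 0) = 0 :=
    hT.seminorm₁_eq_zero (v := fun k => v k) (fun k => hv k) fun k => hK k
  have backward : L₂ (v 0) = 0 :=
    hT.seminorm₂_eq_zero (v := fun k => v (-k))
      (fun k => by rw [← hv]; congr 1; push_cast; ring) fun k => hK _
  simpa only [forward, backward, add_zero, norm_le_zero_iff] using hT.norm_le (v 0)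

theorem norm_le_of_expanding (hT : IsAdaptedPair T L 0 lam C) (v : E) : ‖v‖ ≤ L v := by
  simpa using hT.norm_le v

theorem eq_zero_of_iterate_bounded (hT : IsAdaptedPair T L 0 lam C) {v : E}
    (hK : ∀ k, ‖T^[k] v‖ ≤ K) : v = 0 :=
  norm_le_zero_iff.1 ((hT.norm_le_of_expanding _).trans (hT.seminorm₁_eq_zero
    (v := fun k => T^[k] v) (fun k => Function.iterate_succ_apply' T k v) hK).le)

theorem tendsto_zero_of_iterate_bounded (hT : IsAdaptedPair T L 0 lam C) {v : ℕ → E}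
    (hK : ∀ k, ‖T^[k] (v k)‖ ≤ K) : Filter.Tendsto v Filter.atTop (𝓝 0) := by
  have lam_pos : 0 < lam := one_pos.trans hT.one_lt
  refine squeeze_zero_norm (a := fun k => C * K * lam⁻¹ ^ k) (fun k => ?_) ?_
  · have pow_mul_le : lam ^ k * L (v k) ≤ L (T^[k] (v k)) :=
      geom_le (u := fun i => L (T^[i] (v k))) lam_pos.le k fun i _ => by
        rw [Function.iterate_succ_apply']
        exact hT.expanding _
    rw [inv_pow, ← div_eq_mul_inv, le_div_iff₀' (by positivity)]
    calc lam ^ k * ‖v k‖ ≤ lam ^ k * L (v k) := by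
          gcongr
          exact hT.norm_le_of_expanding _
      _ ≤ L (T^[k] (v k)) := pow_mul_le
      _ ≤ C * ‖T^[k] (v k)‖ := hT.le_norm₁ _
      _ ≤ C * K := mul_le_mul_of_nonneg_left (hK k) hT.pos.le
  · simpa using (tendsto_pow_atTop_nhds_zero_of_lt_one (inv_nonneg.2 lam_pos.le)
      (inv_lt_one_of_one_lt₀ hT.one_lt)).const_mul (C * K)

end IsAdaptedPair

end AdaptedPair

section RealMatrix

variable {ι : Type*}

/-- The inclusion of the real vectors in the complex ones. -/
def complexify : (ι → ℝ) →L[ℝ] (ι → ℂ) :=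
  .pi fun i => Complex.ofRealCLM.comp (.proj i)

theorem complexify_apply (v : ι → ℝ) (i : ι) : complexify v i = v i := rfl

variable [Fintype ι]

theorem norm_complexify (v : ι → ℝ) : ‖complexify v‖ = ‖v‖ := by
  simp only [complexify_apply, Pi.norm_def, Complex.nnnorm_real]

variable [DecidableEq ι] (R : Matrix ι ι ℝ)

/-- A real matrix as a complex linear map. -/
def complexMap : (ι → ℂ) →L[ℂ] (ι → ℂ) :=
  Module.End.toContinuousLinearMap (ι → ℂ) (Matrix.toLin' (R.map Complex.ofReal))

theorem complexMap_apply (w : ι → ℂ) : complexMap R w = R.map Complex.ofReal *ᵥ w := rfl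

theorem complexMap_complexify (v : ι → ℝ) :
    complexMap R (complexify v) = complexify (R *ᵥ v) := by
  ext i
  exact (RingHom.map_mulVec Complex.ofRealHom R v i).symm

theorem re_complexMap (w : ι → ℂ) :
    (fun i => (complexMap R w i).re) = R *ᵥ fun i => (w i).re := by
  ext i
  simp [complexMap_apply, Matrix.mulVec, dotProduct]

theorem isIntegral_complexMap : IsIntegral ℂ (complexMap R) :=
  (Algebra.IsIntegral.isIntegral (R := ℂ) (Matrix.toLin' (R.map Complex.ofReal))).map
    (Module.End.toContinuousLinearMap (ι → ℂ))

theorem hasEigenvalue_of_mem_spectrum_complexMap {μ : ℂ} (hμ : μ ∈ spectrum ℂ (complexMap R)) :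
    Module.End.HasEigenvalue (Matrix.toLin' (R.map Complex.ofReal)) μ := by
  rwa [complexMap, AlgEquiv.spectrum_eq, ← Module.End.hasEigenvalue_iff_mem_spectrum] at hμ

variable {R}

theorem IsAdaptedPair.of_complexMap {L₁ L₂ : AddGroupSeminorm (ι → ℂ)} {lam C : ℝ}
    (h : IsAdaptedPair (complexMap R) L₁ L₂ lam C) :
    IsAdaptedPair (R *ᵥ ·) (L₁.comp complexify.toAddMonoidHom)
      (L₂.comp complexify.toAddMonoidHom) lam C :=
  h.comp _ norm_complexify fun v => (complexMap_complexify R v).symm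

theorem exists_mulVec_eq_add_of_complexMap {M : Type*} [TopologicalSpace M] {f : M → M}
    (h : ∀ g : C(M, ι → ℂ), ∃ φ : C(M, ι → ℂ), ∀ m, complexMap R (φ m) = φ (f m) + g m)
    (g : C(M, ι → ℝ)) : ∃ φ : C(M, ι → ℝ), ∀ m, R *ᵥ φ m = φ (f m) + g m := by
  obtain ⟨φ, hφ⟩ := h ⟨fun m => complexify (g m), by fun_prop⟩
  refine ⟨⟨fun m i => (φ m i).re, by fun_prop⟩, fun m => ?_⟩
  refine (re_complexMap R (φ m)).symm.trans ?_
  rw [hφ]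
  rfl

end RealMatrix

section IntegerMatrix

variable {b : ℕ} {A : Matrix (Fin b) (Fin b) ℤ}

theorem map_ofReal_toRealMatrix (A : Matrix (Fin b) (Fin b) ℤ) :
    (toRealMatrix A).map Complex.ofReal = A.map fun k : ℤ => (k : ℂ) := by
  ext i j
  simp [toRealMatrix]

theorem hasEigenvalue_of_mem_spectrum_toRealMatrix {μ : ℂ}
    (hμ : μ ∈ spectrum ℂ (complexMap (toRealMatrix A))) :
    Module.End.HasEigenvalue (Matrix.toLin' (A.map fun k : ℤ => (k : ℂ))) μ :=
  map_ofReal_toRealMatrix A ▸ hasEigenvalue_of_mem_spectrum_complexMap _ hμ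

theorem isUnit_det_toRealMatrix (hA : A.det ≠ 0) : IsUnit (toRealMatrix A).det := by
  have det_eq : (toRealMatrix A).det = A.det := (RingHom.map_det (Int.castRingHom ℝ) A).symm
  simpa [det_eq] using hA

theorem IsExpandingMatrix.exists_isUnstableInverse (hA : IsExpandingMatrix A) :
    ∃ B, IsUnstableInverse (complexMap (toRealMatrix A)) B ∧ complexMap (toRealMatrix A) * B = 1 :=
  exists_isUnstableInverse_of_one_lt fun μ hμ =>
    hA μ (hasEigenvalue_of_mem_spectrum_toRealMatrix hμ)

theorem IsHyperbolicMatrix.exists_isUnstableInverse (hA : IsHyperbolicMatrix A) :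
    ∃ B, IsUnstableInverse (complexMap (toRealMatrix A)) B :=
  AbelianCover.exists_isUnstableInverse (isIntegral_complexMap _) fun μ hμ =>
    hA μ (hasEigenvalue_of_mem_spectrum_toRealMatrix hμ)

theorem IsExpandingMatrix.exists_isAdaptedPair (hA : IsExpandingMatrix A) :
    ∃ (L : AddGroupSeminorm (Fin b → ℝ)) (lam C : ℝ),
      IsAdaptedPair (toRealMatrix A *ᵥ ·) L 0 lam C := by
  obtain ⟨B, hB, hAB⟩ := hA.exists_isUnstableInverse
  obtain ⟨L₁, L₂, lam, C, adapted, hL₂⟩ := hB.exists_isAdaptedPair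
  obtain rfl := hL₂ hAB
  exact ⟨_, lam, C, adapted.of_complexMap⟩

theorem IsHyperbolicMatrix.exists_isAdaptedPair (hA : IsHyperbolicMatrix A) :
    ∃ (L₁ L₂ : AddGroupSeminorm (Fin b → ℝ)) (lam C : ℝ),
      IsAdaptedPair (toRealMatrix A *ᵥ ·) L₁ L₂ lam C := by
  obtain ⟨B, hB⟩ := hA.exists_isUnstableInverse
  obtain ⟨L₁, L₂, lam, C, adapted, -⟩ := hB.exists_isAdaptedPair
  exact ⟨_, _, lam, C, adapted.of_complexMap⟩

theorem IsExpandingMatrix.det_ne_zero (hA : IsExpandingMatrix A) : A.det ≠ 0 := by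
  intro det_eq_zero
  have det_map : LinearMap.det (Matrix.toLin' (A.map fun k : ℤ => (k : ℂ))) = 0 := by
    rw [LinearMap.det_toLin']
    exact (RingHom.map_det (Int.castRingHom ℂ) A).symm.trans (by simp [det_eq_zero])
  have eigenvalue := ((LinearMap.hasEigenvalue_zero_tfae _).out 3 0).1 det_map
  simpa [zero_le_one.not_gt] using hA 0 eigenvalue

variable {M : Type*} [TopologicalSpace M] [CompactSpace M]

theorem IsExpandingMatrix.exists_mulVec_eq_add (hA : IsExpandingMatrix A) (f : C(M, M))
    (g : C(M, Fin b → ℝ)) :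
    ∃ φ : C(M, Fin b → ℝ), ∀ m, toRealMatrix A *ᵥ φ m = φ (f m) + g m := by
  obtain ⟨B, hB, hAB⟩ := hA.exists_isUnstableInverse
  exact exists_mulVec_eq_add_of_complexMap (hB.exists_map_eq_add_of_mul_eq_one hAB f) g

theorem IsHyperbolicMatrix.exists_mulVec_eq_add (hA : IsHyperbolicMatrix A) (h : M ≃ₜ M)
    (g : C(M, Fin b → ℝ)) :
    ∃ φ : C(M, Fin b → ℝ), ∀ m, toRealMatrix A *ᵥ φ m = φ (h m) + g m := by
  obtain ⟨B, hB⟩ := hA.exists_isUnstableInverse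
  exact exists_mulVec_eq_add_of_complexMap (hB.exists_map_eq_add h) g

end IntegerMatrix

/-! ### Translations and properness of the period map -/

theorem locallyCompactSpace_of_isLocalHomeomorph {N M : Type*} [TopologicalSpace N]
    [TopologicalSpace M] [LocallyCompactSpace M] {p : N → M} (hp : IsLocalHomeomorph p) :
    LocallyCompactSpace N := by
  let : ChartedSpace M N :=
    { atlas := Set.univ
      chartAt := fun x => (hp x).choose
      mem_chart_source := fun x => (hp x).choose_spec.1
      chart_mem_atlas := fun x => Set.mem_univ _ }
  exact ChartedSpace.locallyCompactSpace M N

theorem exists_isCompact_image_eq_univ {N M : Type*} [TopologicalSpace N] [TopologicalSpace M]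
    [WeaklyLocallyCompactSpace N] [CompactSpace M] {p : N → M} (hp : IsOpenMap p)
    (hs : Function.Surjective p) : ∃ K : Set N, IsCompact K ∧ p '' K = Set.univ := by
  choose s hs using hs
  choose K hK hsK using fun m => exists_compact_mem_nhds (s m)
  obtain ⟨t, ht⟩ := isCompact_univ.elim_finite_subcover (fun m => p '' interior (K m))
    (fun m => hp _ isOpen_interior) fun m _ =>
      Set.mem_iUnion.2 ⟨m, s m, mem_interior_iff_mem_nhds.2 (hsK m), hs m⟩
  refine ⟨⋃ m ∈ t, K m, t.isCompact_biUnion fun m _ => hK m, Set.eq_univ_of_forall fun m => ?_⟩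
  obtain ⟨k, hk⟩ := Set.mem_iUnion.1 (ht (Set.mem_univ m))
  obtain ⟨hkt, x, hx, hxm⟩ := Set.mem_iUnion.1 hk
  exact ⟨x, Set.mem_biUnion hkt (interior_subset hx), hxm⟩

theorem norm_intCast_pi {ι : Type*} [Fintype ι] (c : ι → ℤ) : ‖fun i => (c i : ℝ)‖ = ‖c‖ := by
  simp only [Pi.norm_def]
  rfl

theorem eq_of_norm_intCast_sub_lt_one {ι : Type*} [Fintype ι] {c k : ι → ℤ}
    (h : ‖(fun i => (k i : ℝ)) - fun i => (c i : ℝ)‖ < 1) : k = c := by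
  ext i
  have coord_lt := (norm_le_pi_norm _ i).trans_lt h
  rw [Pi.sub_apply, ← Int.cast_sub, Int.norm_cast_real, Int.norm_eq_abs] at coord_lt
  exact sub_eq_zero.1 (Int.abs_lt_one_iff.1 (by exact_mod_cast coord_lt))

namespace IsPeriodMap

variable {N : Type v} {M : Type u} [TopologicalSpace N] [TopologicalSpace M] {b : ℕ}
  {p : C(N, M)} {j : C(N, Fin b → ℝ)}

theorem add_comp (hj : IsPeriodMap p j) (φ : C(M, Fin b → ℝ)) :
    IsPeriodMap p (j + φ.comp p) where
  exists_int x y hxy := by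
    obtain ⟨c, hc⟩ := hj.exists_int x y hxy
    exact ⟨c, by simp [hc, hxy, add_right_comm]⟩
  exists_lift x c := by
    obtain ⟨y, hyx, hy⟩ := hj.exists_lift x c
    exact ⟨y, hyx, by simp [hy, hyx, add_right_comm]⟩
  inj x y hxy h := hj.inj x y hxy (by simpa [hxy] using h)
  deck δ hδ x y := by simp [hδ, add_sub_add_comm, hj.deck δ hδ x y]

theorem continuous_translation (hj : IsPeriodMap p j) (hp : IsLocalHomeomorph p) {τ : N → N}
    {c : Fin b → ℤ} (hτp : ∀ x, p (τ x) = p x) (hτj : ∀ x, j (τ x) = j x + fun i => (c i : ℝ)) :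
    Continuous τ := by
  rw [continuous_iff_continuousAt]
  intro x
  obtain ⟨e, mem_source, he⟩ := hp (τ x)
  have mem_target : p x ∈ e.target := by
    rw [← hτp x, he]
    exact e.map_source mem_source
  have section_eq : e.symm (p x) = τ x := by
    rw [← hτp x, he]
    exact e.left_inv mem_source
  have continuousAt_section : ContinuousAt (fun z => e.symm (p z)) x :=
    ContinuousAt.comp (f := p) (e.continuousAt_symm mem_target) p.continuous.continuousAt
  have continuousAt_difference : ContinuousAt (fun z => j (e.symm (p z)) - j z) x :=
    (ContinuousAt.comp (f := fun z => e.symm (p z)) j.continuous.continuousAt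
      continuousAt_section).sub j.continuous.continuousAt
  -- Integer vectors at distance less than one are equal, so `τ` is the local section near `x`.
  refine continuousAt_section.congr ?_
  filter_upwards [continuousAt_difference.preimage_mem_nhds (Metric.ball_mem_nhds _ one_pos),
    p.continuous.continuousAt.preimage_mem_nhds (e.open_target.mem_nhds mem_target)]
    with z z_near z_target
  have p_section : p (e.symm (p z)) = p z :=
    (congr_fun he _).trans (e.right_inv (x := p z) z_target)
  obtain ⟨k, hk⟩ := hj.exists_int z (e.symm (p z)) p_section.symm
  rw [Set.mem_preimage, Metric.mem_ball, dist_eq_norm, section_eq, hk, hτj, add_sub_cancel_left,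
    add_sub_cancel_left] at z_near
  refine hj.inj _ _ (p_section.trans (hτp z).symm) ?_
  rw [hk, hτj, eq_of_norm_intCast_sub_lt_one z_near]

theorem exists_deck (hj : IsPeriodMap p j) (hp : IsLocalHomeomorph p) (c : Fin b → ℤ) :
    ∃ δ : N ≃ₜ N, (∀ x, p (δ x) = p x) ∧ ∀ x, j (δ x) = j x + fun i => (c i : ℝ) := by
  choose τ hτp hτj using hj.exists_lift
  have continuous_τ (c : Fin b → ℤ) : Continuous fun x => τ x c :=
    hj.continuous_translation hp (hτp · c) (hτj · c)
  have τ_τ_neg (c : Fin b → ℤ) (x : N) : τ (τ x c) (-c) = x := by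
    refine hj.inj _ _ ((hτp _ _).trans (hτp _ _)) ?_
    rw [hτj, hτj]
    ext i
    simp
  exact ⟨⟨⟨fun x => τ x c, fun x => τ x (-c), τ_τ_neg c, fun x => by simpa using τ_τ_neg (-c) x⟩,
    continuous_τ c, continuous_τ (-c)⟩, (hτp · c), (hτj · c)⟩

theorem exists_deck_norm_le (hj : IsPeriodMap p j) (hp : IsLocalHomeomorph p) (x : N) :
    ∃ δ : N ≃ₜ N, (∀ y, p (δ y) = p y) ∧ ‖j (δ x)‖ ≤ 1 := by
  obtain ⟨δ, hδ, hδj⟩ := hj.exists_deck hp fun i => -⌊j x i⌋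
  refine ⟨δ, hδ, (pi_norm_le_iff_of_nonneg zero_le_one).2 fun i => ?_⟩
  rw [hδj, Pi.add_apply, Int.cast_neg, ← sub_eq_add_neg, Int.self_sub_floor, Real.norm_eq_abs,
    Int.abs_fract]
  exact (Int.fract_lt_one _).le

variable [CompactSpace M] [T2Space M]

theorem isCompact_norm_le (hj : IsPeriodMap p j) (hp : IsLocalHomeomorph p)
    (hs : Function.Surjective p) (r : ℝ) : IsCompact {x | ‖j x‖ ≤ r} := by
  have := locallyCompactSpace_of_isLocalHomeomorph hp
  obtain ⟨K, hK, image_K⟩ := exists_isCompact_image_eq_univ hp.isOpenMap hs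
  choose δ hδ hδj using hj.exists_deck hp
  obtain ⟨R, hR⟩ := (hK.image j.continuous).isBounded.exists_norm_le
  have finite_translations : (Metric.closedBall (0 : Fin b → ℤ) (r + R)).Finite :=
    (isCompact_closedBall _ _).finite_of_discrete
  refine (finite_translations.isCompact_biUnion fun c _ =>
    hK.image (δ c).continuous).of_isClosed_subset
      (isClosed_le j.continuous.norm continuous_const) fun x hx => ?_
  obtain ⟨k, hk, hkx⟩ := image_K.ge (Set.mem_univ (p x))
  obtain ⟨c, hc⟩ := hj.exists_int k x hkx
  refine Set.mem_biUnion (x := c) ?_ ⟨k, hk, hj.inj _ _ ((hδ c k).trans hkx) (by rw [hδj, hc])⟩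
  rw [mem_closedBall_zero_iff, ← norm_intCast_pi, ← sub_eq_iff_eq_add'.2 hc]
  exact (norm_sub_le _ _).trans (add_le_add hx (hR _ ⟨k, hk, rfl⟩))

theorem isProperMap (hj : IsPeriodMap p j) (hp : IsLocalHomeomorph p)
    (hs : Function.Surjective p) : IsProperMap j := by
  refine isProperMap_iff_isCompact_preimage.2 ⟨j.continuous, fun K hK => ?_⟩
  obtain ⟨R, hR⟩ := hK.isBounded.exists_norm_le
  exact (hj.isCompact_norm_le hp hs R).of_isClosed_subset (hK.isClosed.preimage j.continuous)
    fun x hx => hR _ hx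

end IsPeriodMap

/-! ### Equivariant metrics -/

section EquivariantMetrics

variable {N : Type v} {M : Type u} [TopologicalSpace N] [TopologicalSpace M] {b : ℕ}
  {p : C(N, M)} {j : C(N, Fin b → ℝ)} {d : N → N → ℝ}

theorem isOpen_iff_of_isInducing {N Z : Type*} [TopologicalSpace N] [PseudoMetricSpace Z]
    {J : N → Z} (hJ : Topology.IsInducing J) {d : N → N → ℝ} {c C : ℝ} (c_pos : 0 < c)
    (C_pos : 0 < C) (dist_le : ∀ x y, dist (J x) (J y) ≤ c * d x y)
    (le_dist : ∀ x y, d x y ≤ C * dist (J x) (J y)) (U : Set N) :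
    IsOpen U ↔ ∀ x ∈ U, ∃ ε > 0, {y | d x y < ε} ⊆ U := by
  have mem_nhds_iff (x : N) : U ∈ 𝓝 x ↔ ∃ ε > 0, {y | d x y < ε} ⊆ U := by
    rw [hJ.nhds_eq_comap, Metric.nhds_basis_ball.comap J |>.mem_iff]
    constructor
    · rintro ⟨ε, hε, h⟩
      refine ⟨ε / c, by positivity, fun y hy => h ?_⟩
      rw [Set.mem_preimage, Metric.mem_ball, dist_comm]
      exact (dist_le x y).trans_lt ((lt_div_iff₀' c_pos).1 hy)
    · rintro ⟨ε, hε, h⟩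
      refine ⟨ε / C, by positivity, fun y hy => h ?_⟩
      rw [Set.mem_preimage, Metric.mem_ball, dist_comm] at hy
      exact (le_dist x y).trans_lt ((lt_div_iff₀' C_pos).1 hy)
  simp only [isOpen_iff_mem_nhds, mem_nhds_iff]

theorem IsEquivariantPseudoMetric.nonneg (hd : IsEquivariantPseudoMetric p d) (x y : N) :
    0 ≤ d x y := by
  have := hd.triangle x y x
  rw [hd.self, hd.symm y x] at this
  linarith

theorem IsEquivariantMetric.continuous (hd : IsEquivariantMetric p d) :
    Continuous fun q : N × N => d q.1 q.2 := by
  let : MetricSpace N := MetricSpace.ofDistTopology d (fun x => (hd.eq_zero_iff x x).2 rfl) hd.symm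
    hd.triangle (fun U => hd.isOpen_iff U) fun x y h => (hd.eq_zero_iff x y).1 h
  exact continuous_dist

theorem IsEquivariantMetric.isEquivariantPseudoMetric (hd : IsEquivariantMetric p d) :
    IsEquivariantPseudoMetric p d :=
  ⟨fun x => (hd.eq_zero_iff x x).2 rfl, hd.symm, hd.triangle, hd.equivariant⟩

theorem IsPeriodMap.isEquivariantPseudoMetric (hj : IsPeriodMap p j)
    (L : AddGroupSeminorm (Fin b → ℝ)) :
    IsEquivariantPseudoMetric p fun x y => L (j x - j y) where
  self x := by rw [sub_self, map_zero]
  symm x y := map_sub_rev L _ _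
  triangle x y z := by
    rw [← sub_add_sub_cancel (j x) (j y) (j z)]
    exact map_add_le_add L _ _
  equivariant δ hδ x y := by rw [hj.deck δ hδ]

variable [CompactSpace M] [T2Space M]

theorem IsPeriodMap.isEquivariantMetric (hj : IsPeriodMap p j) (hp : IsLocalHomeomorph p)
    (hs : Function.Surjective p) (inj : Function.Injective j) {L : AddGroupSeminorm (Fin b → ℝ)}
    {c C : ℝ} (c_pos : 0 < c) (C_pos : 0 < C) (norm_le : ∀ v, ‖v‖ ≤ c * L v)
    (le_norm : ∀ v, L v ≤ C * ‖v‖) : IsEquivariantMetric p fun x y => L (j x - j y) where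
  eq_zero_iff x y := by
    refine ⟨fun h => inj (sub_eq_zero.1 ?_), fun h => by rw [h, sub_self, map_zero]⟩
    simpa [h] using norm_le (j x - j y)
  symm := (hj.isEquivariantPseudoMetric L).symm
  triangle := (hj.isEquivariantPseudoMetric L).triangle
  equivariant := (hj.isEquivariantPseudoMetric L).equivariant
  isOpen_iff :=
    have closedEmbedding : Topology.IsClosedEmbedding j :=
      .of_continuous_injective_isClosedMap j.continuous inj (hj.isProperMap hp hs).isClosedMap
    isOpen_iff_of_isInducing closedEmbedding.isInducing c_pos C_pos
      (fun _ _ => dist_eq_norm (j _) (j _) ▸ norm_le _)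
      (fun _ _ => dist_eq_norm (j _) (j _) ▸ le_norm _)

theorem IsPeriodMap.exists_isProperMetric [TopologicalSpace.MetrizableSpace M]
    (hj : IsPeriodMap p j) (hp : IsLocalHomeomorph p) (hs : Function.Surjective p) :
    ∃ d : N → N → ℝ, IsEquivariantMetric p d ∧ IsProperMetric d := by
  let : MetricSpace M := TopologicalSpace.metrizableSpaceMetric M
  let J : N → (Fin b → ℝ) × M := fun x => (j x, p x)
  have continuous_J : Continuous J := j.continuous.prodMk p.continuous
  have injective_J : Function.Injective J := fun x y h =>
    hj.inj x y (congrArg Prod.snd h) (congrArg Prod.fst h)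
  have closedEmbedding_J : Topology.IsClosedEmbedding J :=
    .of_continuous_injective_isClosedMap continuous_J injective_J
      (isProperMap_of_comp_of_t2 continuous_J continuous_fst (hj.isProperMap hp hs)).isClosedMap
  refine ⟨fun x y => dist (J x) (J y), ⟨fun x y => ?_, fun x y => dist_comm _ _,
    fun x y z => dist_triangle _ _ _, fun U => ?_, fun δ hδ x y => ?_⟩, fun x r => ?_⟩
  · exact dist_eq_zero.trans injective_J.eq_iff
  · exact isOpen_iff_of_isInducing closedEmbedding_J.isInducing one_pos one_pos
      (fun x y => (one_mul _).ge) (fun x y => (one_mul _).ge) U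
  · have dist_j : dist (j (δ x)) (j (δ y)) = dist (j x) (j y) := by
      rw [dist_eq_norm, dist_eq_norm, hj.deck δ hδ]
    simp only [J, Prod.dist_eq, hδ, dist_j]
  · simpa only [Metric.closedBall, Set.preimage_ofPred_eq, dist_comm] using
      closedEmbedding_J.isCompact_preimage (isCompact_closedBall (J x) r)

namespace IsEquivariantMetric

theorem exists_dist_le (hd : IsEquivariantMetric p d) (hj : IsPeriodMap p j)
    (hp : IsLocalHomeomorph p) (hs : Function.Surjective p) (r : ℝ) :
    ∃ R, ∀ x y, ‖j x - j y‖ ≤ r → d x y ≤ R := by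
  have isCompact_ball := hj.isCompact_norm_le hp hs (1 + r)
  obtain ⟨R, hR⟩ := ((isCompact_ball.prod isCompact_ball).image hd.continuous).bddAbove
  refine ⟨R, fun x y hxy => ?_⟩
  obtain ⟨δ, hδ, norm_δx⟩ := hj.exists_deck_norm_le hp x
  have norm_δy : ‖j (δ y)‖ ≤ 1 + r := by
    rw [← sub_sub_self (j (δ x)) (j (δ y)), hj.deck δ hδ]
    exact (norm_sub_le _ _).trans (add_le_add norm_δx hxy)
  rw [← hd.equivariant δ hδ]
  exact hR ⟨(δ x, δ y), ⟨norm_δx.trans (le_add_of_nonneg_right ((norm_nonneg _).trans hxy)),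
    norm_δy⟩, rfl⟩

theorem exists_norm_sub_le (hd : IsEquivariantMetric p d) (proper : IsProperMetric d)
    (hj : IsPeriodMap p j) (hp : IsLocalHomeomorph p) (hs : Function.Surjective p) (K : ℝ) :
    ∃ R, ∀ x y, d x y ≤ K → ‖j x - j y‖ ≤ R := by
  rcases isEmpty_or_nonempty N with _ | ⟨⟨z⟩⟩
  · exact ⟨0, fun x => isEmptyElim x⟩
  obtain ⟨R₁, hR₁⟩ := ((hj.isCompact_norm_le hp hs 1).image
    (hd.continuous.comp (Continuous.prodMk_right z))).bddAbove
  obtain ⟨R, hR⟩ := ((proper z (R₁ + K)).image j.continuous).isBounded.exists_norm_le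
  refine ⟨1 + R, fun x y hxy => ?_⟩
  obtain ⟨δ, hδ, norm_δx⟩ := hj.exists_deck_norm_le hp x
  have dist_δy : d z (δ y) ≤ R₁ + K :=
    calc d z (δ y) ≤ d z (δ x) + d (δ x) (δ y) := hd.triangle _ _ _
      _ ≤ R₁ + K := add_le_add (hR₁ ⟨δ x, norm_δx, rfl⟩) (by rwa [hd.equivariant δ hδ])
  rw [← hj.deck δ hδ]
  exact (norm_sub_le _ _).trans (add_le_add norm_δx (hR _ ⟨δ y, dist_δy, rfl⟩))

end IsEquivariantMetric

end EquivariantMetrics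

/-! ### The map to the torus -/

section TorusMap

variable {N : Type v} {M : Type u} [TopologicalSpace N] [TopologicalSpace M] {b : ℕ}
  {p : C(N, M)} {j βt : C(N, Fin b → ℝ)}

theorem exists_add_comp_semiconj (hp : IsLocalHomeomorph p) (hs : Function.Surjective p)
    {R : Matrix (Fin b) (Fin b) ℝ} {f : M → M} {F : C(N, N)} (hF : ∀ x, p (F x) = f (p x))
    (hR : ∀ x y, p x = p y → j (F y) - j (F x) = R *ᵥ (j y - j x))
    (solvable : ∀ g : C(M, Fin b → ℝ), ∃ φ : C(M, Fin b → ℝ), ∀ m, R *ᵥ φ m = φ (f m) + g m) :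
    ∃ φ : C(M, Fin b → ℝ), Function.Semiconj (j + φ.comp p) F (R *ᵥ ·) := by
  have isQuotientMap_p := hp.isOpenMap.isQuotientMap p.continuous hs
  let defect : C(N, Fin b → ℝ) := ⟨fun x => j (F x) - R *ᵥ j x,
    (j.continuous.comp F.continuous).sub (Continuous.matrix_mulVec continuous_const j.continuous)⟩
  have factors : Function.FactorsThrough defect p := fun x y hxy => by
    refine (sub_eq_sub_iff_sub_eq_sub.1 ?_).symm
    rw [hR x y hxy, Matrix.mulVec_sub]
  obtain ⟨φ, hφ⟩ := solvable (isQuotientMap_p.lift defect factors)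
  refine ⟨φ, fun x => ?_⟩
  have lift_defect : isQuotientMap_p.lift defect factors (p x) = j (F x) - R *ᵥ j x :=
    DFunLike.congr_fun (isQuotientMap_p.lift_comp defect factors) x
  simp only [ContinuousMap.add_apply, ContinuousMap.comp_apply, Matrix.mulVec_add, hφ,
    lift_defect, hF]
  abel

theorem unitAddCircle_coe_eq_iff {s t : ℝ} :
    (s : UnitAddCircle) = t ↔ ∃ k : ℤ, s = t + k := by
  rw [← sub_eq_zero, ← AddCircle.coe_sub, AddCircle.coe_eq_zero_iff]
  simp only [zsmul_eq_mul, mul_one, eq_comm, sub_eq_iff_eq_add']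

theorem IsPeriodMap.exists_torus_map (hβ : IsPeriodMap p βt) (hp : IsLocalHomeomorph p)
    (hs : Function.Surjective p) :
    ∃ β : C(M, Torus b), ∀ x i, β (p x) i = (βt x i : UnitAddCircle) := by
  have isQuotientMap_p := hp.isOpenMap.isQuotientMap p.continuous hs
  let g : C(N, Torus b) := ⟨fun x i => (βt x i : UnitAddCircle), continuous_pi fun i =>
    (AddCircle.continuous_mk' 1).comp ((continuous_apply i).comp βt.continuous)⟩
  have factors : Function.FactorsThrough g p := fun x y hxy => by
    obtain ⟨c, hc⟩ := hβ.exists_int y x hxy.symm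
    exact funext fun i => unitAddCircle_coe_eq_iff.2 ⟨c i, congr_fun hc i⟩
  exact ⟨isQuotientMap_p.lift g factors, fun x i =>
    congr_fun (DFunLike.congr_fun (isQuotientMap_p.lift_comp g factors) x) i⟩

theorem coe_toRealMatrix_mulVec (A : Matrix (Fin b) (Fin b) ℤ) (v : Fin b → ℝ) (i : Fin b) :
    ((toRealMatrix A *ᵥ v) i : UnitAddCircle) = toralEndomorphism A (fun k => (v k : _)) i := by
  let π : ℝ →+ UnitAddCircle := QuotientAddGroup.mk' (AddSubgroup.zmultiples (1 : ℝ))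
  change π (∑ k, (A i k : ℝ) * v k) = ∑ k, A i k • π (v k)
  simp only [map_sum, ← zsmul_eq_mul, map_zsmul]

theorem torus_map_comp {N M : Type*} {p : N → M} (hs : Function.Surjective p)
    {A : Matrix (Fin b) (Fin b) ℤ} {f : M → M} {F : N → N} (hF : ∀ x, p (F x) = f (p x))
    {βt : N → Fin b → ℝ} (semiconj : Function.Semiconj βt F (toRealMatrix A *ᵥ ·))
    {β : M → Torus b} (hβ : ∀ x i, β (p x) i = (βt x i : UnitAddCircle)) (y : M) :
    β (f y) = toralEndomorphism A (β y) := by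
  obtain ⟨x, rfl⟩ := hs y
  have β_p : β (p x) = fun i => (βt x i : UnitAddCircle) := funext (hβ x)
  ext i
  rw [← hF, hβ, semiconj x, coe_toRealMatrix_mulVec, β_p]

theorem IsPeriodMap.injective_torus_map_iff (hβt : IsPeriodMap p βt) (hs : Function.Surjective p)
    {β : M → Torus b} (hβ : ∀ x i, β (p x) i = (βt x i : UnitAddCircle)) :
    Function.Injective β ↔ Function.Injective βt := by
  constructor
  · intro inj x y hxy
    exact hβt.inj x y (inj (funext fun i => by rw [hβ, hβ, hxy])) hxy
  · intro inj m m' hm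
    obtain ⟨x, rfl⟩ := hs m
    obtain ⟨y, rfl⟩ := hs m'
    have integer_difference (i : Fin b) : ∃ c : ℤ, βt x i = βt y i + c :=
      unitAddCircle_coe_eq_iff.1 (by rw [← hβ, ← hβ, hm])
    choose c hc using integer_difference
    obtain ⟨z, p_z, βt_z⟩ := hβt.exists_lift y c
    rw [← p_z, inj (βt_z.trans (funext hc).symm)]

end TorusMap

/-! ### Orbits in the cover -/

section Orbits

variable {N : Type*} {b : ℕ} {R : Matrix (Fin b) (Fin b) ℝ} {L₁ L₂ L : AddGroupSeminorm (Fin b → ℝ)}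
  {lam C K : ℝ} {j βt : N → Fin b → ℝ}

theorem norm_sub_add_comp_le {N M : Type*} [TopologicalSpace N] [TopologicalSpace M]
    [CompactSpace M] {p : C(N, M)} {j : C(N, Fin b → ℝ)} (φ : C(M, Fin b → ℝ)) (x : N) :
    ‖j x - (j + φ.comp p) x‖ ≤ ‖φ‖ := by
  simpa using φ.norm_coe_le_norm (p x)

theorem mulVec_iterate (R : Matrix (Fin b) (Fin b) ℝ) (k : ℕ) (v : Fin b → ℝ) :
    (R *ᵥ ·)^[k] v = R ^ k *ᵥ v := by
  induction k with
  | zero => simp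
  | succ k ih => rw [Function.iterate_succ_apply', ih, Matrix.mulVec_mulVec, pow_succ']

theorem tendsto_inv_pow_mulVec (hR : IsUnit R.det) (adapted : IsAdaptedPair (R *ᵥ ·) L 0 lam C)
    {F : N → N} (semiconj : Function.Semiconj βt F (R *ᵥ ·)) (hK : ∀ x, ‖j x - βt x‖ ≤ K) (x : N) :
    Filter.Tendsto (fun k : ℕ => R⁻¹ ^ k *ᵥ j (F^[k] x)) Filter.atTop (𝓝 (βt x)) := by
  refine tendsto_sub_nhds_zero_iff.1 (adapted.tendsto_zero_of_iterate_bounded (K := K) fun k => ?_)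
  have pow_mul_inv_pow : R ^ k * R⁻¹ ^ k = 1 := by
    rw [Matrix.inv_pow', Matrix.mul_nonsing_inv _ (by simpa using hR.pow k)]
  rw [mulVec_iterate, Matrix.mulVec_sub, Matrix.mulVec_mulVec, pow_mul_inv_pow, Matrix.one_mulVec,
    ← mulVec_iterate, ← (semiconj.iterate_right k).eq]
  exact hK _

variable [TopologicalSpace N] {H : N ≃ₜ N}

theorem semiconj_zpow (hR : IsUnit R.det) (semiconj : Function.Semiconj βt H (R *ᵥ ·)) (i : ℤ) :
    Function.Semiconj βt (H ^ i : N ≃ₜ N) (R ^ i *ᵥ ·) := by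
  have semiconj_inv (x : N) : βt (H⁻¹ x) = R⁻¹ *ᵥ βt x := by
    have apply_inv : βt x = R *ᵥ βt (H⁻¹ x) := by
      rw [← semiconj.eq, ← Homeomorph.mul_apply, mul_inv_cancel, Homeomorph.one_apply]
    rw [apply_inv, Matrix.mulVec_mulVec, Matrix.nonsing_inv_mul _ hR, Matrix.one_mulVec]
  induction i using Int.induction_on with
  | zero => simp [Function.Semiconj]
  | succ k ih =>
    intro x
    simp only [zpow_add_one, Matrix.zpow_add_one hR, Homeomorph.mul_apply, ih.eq, semiconj.eq,
      Matrix.mulVec_mulVec]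
  | pred k ih =>
    intro x
    simp only [zpow_sub_one, Matrix.zpow_sub_one hR, Homeomorph.mul_apply, ih.eq, semiconj_inv,
      Matrix.mulVec_mulVec]

theorem IsAdaptedPair.eq_zero_of_zpow_bounded (adapted : IsAdaptedPair (R *ᵥ ·) L₁ L₂ lam C)
    (hR : IsUnit R.det) {v : Fin b → ℝ} (hK : ∀ i : ℤ, ‖R ^ i *ᵥ v‖ ≤ K) : v = 0 := by
  simpa using adapted.eq_zero_of_bounded (v := fun i => R ^ i *ᵥ v)
    (fun i => by rw [add_comm, Matrix.zpow_one_add hR, Matrix.mulVec_mulVec]) hK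

theorem bounded_orbit_iff_eq (hR : IsUnit R.det) (adapted : IsAdaptedPair (R *ᵥ ·) L₁ L₂ lam C)
    (semiconj : Function.Semiconj βt H (R *ᵥ ·)) (hK : ∀ x, ‖j x - βt x‖ ≤ K) (x : N)
    (y : Fin b → ℝ) : (∃ K, ∀ i : ℤ, ‖j ((H ^ i) x) - R ^ i *ᵥ y‖ ≤ K) ↔ y = βt x := by
  have semiconj_pow (i : ℤ) : βt ((H ^ i) x) = R ^ i *ᵥ βt x := semiconj_zpow hR semiconj i x
  constructor
  · rintro ⟨K', hK'⟩
    refine sub_eq_zero.1 (adapted.eq_zero_of_zpow_bounded hR (K := K + K') fun i => ?_)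
    rw [Matrix.mulVec_sub, ← semiconj_pow, ← sub_sub_sub_cancel_left _ _ (j ((H ^ i) x))]
    exact norm_sub_le_of_le (hK _) (hK' i)
  · rintro rfl
    exact ⟨K, fun i => semiconj_pow i ▸ hK _⟩

end Orbits

/-! ### The equivalent conditions -/

theorem sqrt_add_sq_add_le (a b c d : ℝ) :
    √((a + b) ^ 2 + (c + d) ^ 2) ≤ √(a ^ 2 + c ^ 2) + √(b ^ 2 + d ^ 2) := by
  simp only [← Complex.norm_add_mul_I]
  refine Eq.trans_le ?_ (norm_add_le _ _)
  congr 1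
  push_cast
  ring

/-- The Euclidean combination of two seminorms, which turns the pair of pseudo-metrics of a
hyperbolic map into one metric. -/
def l2Seminorm {E : Type*} [AddGroup E] (L₁ L₂ : AddGroupSeminorm E) : AddGroupSeminorm E where
  toFun v := √(L₁ v ^ 2 + L₂ v ^ 2)
  map_zero' := by simp
  neg' v := by simp only [map_neg_eq_map]
  add_le' v w := (Real.sqrt_le_sqrt (add_le_add
    (pow_le_pow_left₀ (apply_nonneg _ _) (map_add_le_add L₁ v w) 2)
    (pow_le_pow_left₀ (apply_nonneg _ _) (map_add_le_add L₂ v w) 2))).trans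
      (sqrt_add_sq_add_le _ _ _ _)

theorem IsAdaptedPair.norm_le_l2Seminorm {E : Type*} [SeminormedAddCommGroup E] {T : E → E}
    {L₁ L₂ : AddGroupSeminorm E} {lam C : ℝ} (hT : IsAdaptedPair T L₁ L₂ lam C) (v : E) :
    ‖v‖ ≤ 2 * l2Seminorm L₁ L₂ v := by
  have le₁ : L₁ v ≤ l2Seminorm L₁ L₂ v :=
    Real.le_sqrt_of_sq_le (le_add_of_nonneg_right (sq_nonneg _))
  have le₂ : L₂ v ≤ l2Seminorm L₁ L₂ v :=
    Real.le_sqrt_of_sq_le (le_add_of_nonneg_left (sq_nonneg _))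
  linarith [hT.norm_le v]

theorem IsAdaptedPair.l2Seminorm_le_norm {E : Type*} [SeminormedAddCommGroup E] {T : E → E}
    {L₁ L₂ : AddGroupSeminorm E} {lam C : ℝ} (hT : IsAdaptedPair T L₁ L₂ lam C) (v : E) :
    l2Seminorm L₁ L₂ v ≤ 2 * C * ‖v‖ := by
  have nonneg₁ : 0 ≤ L₁ v := apply_nonneg _ _
  have nonneg₂ : 0 ≤ L₂ v := apply_nonneg _ _
  calc √(L₁ v ^ 2 + L₂ v ^ 2) ≤ L₁ v + L₂ v :=
        Real.sqrt_le_iff.2 ⟨by positivity, by nlinarith⟩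
    _ ≤ 2 * C * ‖v‖ := by linarith [hT.le_norm₁ v, hT.le_norm₂ v]

section Equivalences

variable {N : Type v} {M : Type u} [TopologicalSpace N] [TopologicalSpace M] {b : ℕ}
  {p : C(N, M)} {βt : C(N, Fin b → ℝ)} {R : Matrix (Fin b) (Fin b) ℝ}
  {L₁ L₂ L : AddGroupSeminorm (Fin b → ℝ)} {lam C : ℝ}

theorem IsEquivariantPseudoMetric.eq_zero_of_expanding {d : N → N → ℝ}
    (hd : IsEquivariantPseudoMetric p d) (one_lt : 1 < lam) {F : N → N}
    (expanding : ∀ x y, lam * d x y ≤ d (F x) (F y)) {x y : N} {K : ℝ}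
    (bounded : ∀ k, d (F^[k] x) (F^[k] y) ≤ K) : d x y = 0 := by
  refine (nonpos_of_mul_le_succ_of_bounded (a := fun k => d (F^[k] x) (F^[k] y)) one_lt
    (fun k => ?_) bounded).antisymm (hd.nonneg x y)
  simp only [Function.iterate_succ_apply']
  exact expanding _ _

variable [CompactSpace M] [T2Space M]

theorem IsPeriodMap.tfae_separates_orbits [TopologicalSpace.MetrizableSpace M] {ι : Type*}
    (hβ : IsPeriodMap p βt) (hp : IsLocalHomeomorph p) (hs : Function.Surjective p)
    {G : ι → N → N} (map_eq : ∀ x y, βt x = βt y → ∀ i, βt (G i x) = βt (G i y))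
    (eq_of_bounded : ∀ x y K, (∀ i, ‖βt (G i x) - βt (G i y)‖ ≤ K) → βt x = βt y) :
    List.TFAE [
      Function.Injective βt,
      ∃ d : N → N → ℝ, IsEquivariantMetric p d ∧ IsProperMetric d ∧
        ∀ x y, (∃ K, ∀ i, d (G i x) (G i y) < K) → x = y,
      ∀ d : N → N → ℝ, IsEquivariantMetric p d → IsProperMetric d →
        ∀ x y, (∃ K, ∀ i, d (G i x) (G i y) < K) → x = y] := by
  tfae_have 1 → 3 := by
    rintro inj d hd proper x y ⟨K, hK⟩
    obtain ⟨R, hR⟩ := hd.exists_norm_sub_le proper hβ hp hs K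
    exact inj (eq_of_bounded x y R fun i => hR _ _ (hK i).le)
  tfae_have 3 → 2 := fun h =>
    have ⟨d, hd, proper⟩ := hβ.exists_isProperMetric hp hs
    ⟨d, hd, proper, h d hd proper⟩
  tfae_have 2 → 1 := by
    rintro ⟨d, hd, -, h⟩ x y hxy
    obtain ⟨R, hR⟩ := hd.exists_dist_le hβ hp hs 0
    refine h x y ⟨R + 1, fun i => (hR _ _ ?_).trans_lt (lt_add_one R)⟩
    rw [map_eq x y hxy i, sub_self, norm_zero]
  tfae_finish

theorem IsPeriodMap.isCoverExpanding (hβ : IsPeriodMap p βt) (hp : IsLocalHomeomorph p)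
    (hs : Function.Surjective p) (adapted : IsAdaptedPair (R *ᵥ ·) L 0 lam C) {F : N → N}
    (semiconj : Function.Semiconj βt F (R *ᵥ ·)) (inj : Function.Injective βt) :
    IsCoverExpanding p F := by
  refine ⟨_, hβ.isEquivariantMetric hp hs inj one_pos adapted.pos (fun v => ?_) adapted.le_norm₁,
    lam, adapted.one_lt, fun x y => ?_⟩
  · rw [one_mul]
    exact adapted.norm_le_of_expanding v
  · rw [semiconj x, semiconj y, ← Matrix.mulVec_sub]
    exact adapted.expanding _

theorem IsEquivariantMetric.exists_iterate_le {d : N → N → ℝ} (hd : IsEquivariantMetric p d)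
    (hβ : IsPeriodMap p βt) (hp : IsLocalHomeomorph p) (hs : Function.Surjective p) {F : N → N}
    {T : (Fin b → ℝ) → Fin b → ℝ} (semiconj : Function.Semiconj βt F T) :
    ∃ K, ∀ x y, βt x = βt y → ∀ k, d (F^[k] x) (F^[k] y) ≤ K := by
  obtain ⟨K, hK⟩ := hd.exists_dist_le hβ hp hs 0
  refine ⟨K, fun x y hxy k => hK _ _ ?_⟩
  rw [semiconj.iterate_right k, semiconj.iterate_right k, hxy, sub_self, norm_zero]

theorem IsCoverExpanding.injective {F : N → N} (hF : IsCoverExpanding p F)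
    (hβ : IsPeriodMap p βt) (hp : IsLocalHomeomorph p) (hs : Function.Surjective p)
    {T : (Fin b → ℝ) → Fin b → ℝ} (semiconj : Function.Semiconj βt F T) :
    Function.Injective βt := by
  obtain ⟨d, hd, lam, one_lt, expanding⟩ := hF
  obtain ⟨K, hK⟩ := hd.exists_iterate_le hβ hp hs semiconj
  exact fun x y hxy => (hd.eq_zero_iff x y).1
    (hd.isEquivariantPseudoMetric.eq_zero_of_expanding one_lt expanding (hK x y hxy))

theorem IsPeriodMap.isCoverHyperbolic (hβ : IsPeriodMap p βt) (hp : IsLocalHomeomorph p)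
    (hs : Function.Surjective p) (adapted : IsAdaptedPair (R *ᵥ ·) L₁ L₂ lam C) {H : N ≃ₜ N}
    (semiconj : Function.Semiconj βt H (R *ᵥ ·)) (inj : Function.Injective βt) :
    IsCoverHyperbolic p H := by
  refine ⟨_, _, hβ.isEquivariantPseudoMetric L₁, hβ.isEquivariantPseudoMetric L₂,
    hβ.isEquivariantMetric hp hs inj two_pos (mul_pos two_pos adapted.pos)
      adapted.norm_le_l2Seminorm adapted.l2Seminorm_le_norm,
    lam, adapted.one_lt, fun x y => ?_, fun x y => ?_⟩
  · rw [semiconj x, semiconj y, ← Matrix.mulVec_sub]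
    exact adapted.expanding _
  · obtain ⟨x, rfl⟩ := H.surjective x
    obtain ⟨y, rfl⟩ := H.surjective y
    rw [semiconj x, semiconj y, ← Matrix.mulVec_sub, H.symm_apply_apply, H.symm_apply_apply]
    exact adapted.contracting _

theorem IsCoverHyperbolic.injective {H : N ≃ₜ N} (hH : IsCoverHyperbolic p H)
    (hβ : IsPeriodMap p βt) (hp : IsLocalHomeomorph p) (hs : Function.Surjective p)
    (hR : IsUnit R.det) (semiconj : Function.Semiconj βt H (R *ᵥ ·)) :
    Function.Injective βt := by
  obtain ⟨d₁, d₂, hd₁, hd₂, hd, lam, one_lt, expanding, contracting⟩ := hH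
  have semiconj_symm : Function.Semiconj βt H.symm (R ^ (-1 : ℤ) *ᵥ ·) := by
    simpa only [zpow_neg_one] using! semiconj_zpow hR semiconj (-1)
  obtain ⟨K₁, hK₁⟩ := hd.exists_iterate_le hβ hp hs semiconj
  obtain ⟨K₂, hK₂⟩ := hd.exists_iterate_le hβ hp hs semiconj_symm
  intro x y hxy
  have d₁_eq_zero : d₁ x y = 0 := hd₁.eq_zero_of_expanding one_lt expanding fun k =>
    (Real.le_sqrt_of_sq_le (le_add_of_nonneg_right (sq_nonneg _))).trans (hK₁ x y hxy k)
  have d₂_eq_zero : d₂ x y = 0 := hd₂.eq_zero_of_expanding one_lt contracting fun k =>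
    (Real.le_sqrt_of_sq_le (le_add_of_nonneg_left (sq_nonneg _))).trans (hK₂ x y hxy k)
  exact (hd.eq_zero_iff x y).1 (by simp [d₁_eq_zero, d₂_eq_zero])

end Equivalences

section Main

variable {N : Type v} {M : Type u} [TopologicalSpace N] [TopologicalSpace M] {b : ℕ}
  {p : C(N, M)} {j : C(N, Fin b → ℝ)} {A : Matrix (Fin b) (Fin b) ℤ} [CompactSpace M] [T2Space M]
  [TopologicalSpace.MetrizableSpace M]

theorem IsPeriodMap.expanding (hj : IsPeriodMap p j) (hp : IsLocalHomeomorph p)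
    (hs : Function.Surjective p) {f : C(M, M)} {F : C(N, N)} (hF : ∀ x, p (F x) = f (p x))
    (hFj : ∀ x y, p x = p y → j (F y) - j (F x) = toRealMatrix A *ᵥ (j y - j x))
    (hA : IsExpandingMatrix A) :
    ∃ (βt : C(N, Fin b → ℝ)) (β : C(M, Torus b)),
      (∀ x, Filter.Tendsto (fun k : ℕ => ((toRealMatrix A)⁻¹ ^ k) *ᵥ j (F^[k] x))
        Filter.atTop (𝓝 (βt x))) ∧
      (∀ x i, β (p x) i = (βt x i : UnitAddCircle)) ∧
      (∀ y, β (f y) = toralEndomorphism A (β y)) ∧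
      List.TFAE [
        Function.Injective β,
        IsCoverExpanding p F,
        ∃ d : N → N → ℝ, IsEquivariantMetric p d ∧ IsProperMetric d ∧ NoShadowing d F,
        ∀ d : N → N → ℝ, IsEquivariantMetric p d → IsProperMetric d → NoShadowing d F] := by
  obtain ⟨L, lam, C, adapted⟩ := hA.exists_isAdaptedPair
  obtain ⟨φ, semiconj⟩ := exists_add_comp_semiconj hp hs hF hFj (hA.exists_mulVec_eq_add f)
  have hβt : IsPeriodMap p (j + φ.comp p) := hj.add_comp φ
  obtain ⟨β, hβ⟩ := hβt.exists_torus_map hp hs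
  have semiconj_pow := fun k => semiconj.iterate_right k
  refine ⟨_, β, tendsto_inv_pow_mulVec (isUnit_det_toRealMatrix hA.det_ne_zero) adapted semiconj
    (norm_sub_add_comp_le φ), hβ, torus_map_comp hs hF semiconj hβ, ?_⟩
  rw [hβt.injective_torus_map_iff hs hβ]
  have tfae := hβt.tfae_separates_orbits (G := fun k => F^[k]) hp hs
    (fun x y hxy k => by rw [semiconj_pow k x, semiconj_pow k y, hxy])
    fun x y K hK => sub_eq_zero.1 (adapted.eq_zero_of_iterate_bounded fun k => by
      simpa only [mulVec_iterate, Matrix.mulVec_sub, (semiconj_pow k).eq] using hK k)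
  tfae_have 1 → 2 := hβt.isCoverExpanding hp hs adapted semiconj
  tfae_have 2 → 1 := fun h => h.injective hβt hp hs semiconj
  tfae_have 1 ↔ 3 := tfae.out 0 1
  tfae_have 1 ↔ 4 := tfae.out 0 2
  tfae_finish

theorem IsPeriodMap.hyperbolic (hj : IsPeriodMap p j) (hp : IsLocalHomeomorph p)
    (hs : Function.Surjective p) {h : M ≃ₜ M} {H : N ≃ₜ N} (hH : ∀ x, p (H x) = h (p x))
    (hHj : ∀ x y, p x = p y → j (H y) - j (H x) = toRealMatrix A *ᵥ (j y - j x))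
    (det_ne_zero : A.det ≠ 0) (hA : IsHyperbolicMatrix A) :
    ∃ (βt : C(N, Fin b → ℝ)) (β : C(M, Torus b)),
      (∀ x y, (∃ K : ℝ, ∀ i : ℤ, ‖j ((H ^ i) x) - (toRealMatrix A ^ i) *ᵥ y‖ ≤ K) ↔ y = βt x) ∧
      (∀ x i, β (p x) i = (βt x i : UnitAddCircle)) ∧
      (∀ y, β (h y) = toralEndomorphism A (β y)) ∧
      List.TFAE [
        Function.Injective β,
        IsCoverHyperbolic p H,
        ∃ d : N → N → ℝ, IsEquivariantMetric p d ∧ IsProperMetric d ∧ NoTwoSidedShadowing d H,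
        ∀ d : N → N → ℝ, IsEquivariantMetric p d → IsProperMetric d →
          NoTwoSidedShadowing d H] := by
  have hR := isUnit_det_toRealMatrix det_ne_zero
  obtain ⟨L₁, L₂, lam, C, adapted⟩ := hA.exists_isAdaptedPair
  obtain ⟨φ, semiconj⟩ :=
    exists_add_comp_semiconj (F := (H : C(N, N))) hp hs hH hHj (hA.exists_mulVec_eq_add h)
  have hβt : IsPeriodMap p (j + φ.comp p) := hj.add_comp φ
  obtain ⟨β, hβ⟩ := hβt.exists_torus_map hp hs
  have semiconj_pow := semiconj_zpow (H := H) hR semiconj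
  refine ⟨_, β, bounded_orbit_iff_eq hR adapted semiconj (norm_sub_add_comp_le φ), hβ,
    torus_map_comp hs hH semiconj hβ, ?_⟩
  rw [hβt.injective_torus_map_iff hs hβ]
  have tfae := hβt.tfae_separates_orbits (G := fun i : ℤ => (H ^ i : N ≃ₜ N)) hp hs
    (fun x y hxy i => by rw [semiconj_pow i x, semiconj_pow i y, hxy])
    fun x y K hK => sub_eq_zero.1 (adapted.eq_zero_of_zpow_bounded hR fun i => by
      simpa only [Matrix.mulVec_sub, (semiconj_pow i).eq] using hK i)
  tfae_have 1 → 2 := hβt.isCoverHyperbolic hp hs adapted semiconj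
  tfae_have 2 → 1 := fun h => h.injective hβt hp hs hR semiconj
  tfae_have 1 ↔ 3 := tfae.out 0 1
  tfae_have 1 ↔ 4 := tfae.out 0 2
  tfae_finish

end Main

theorem metrizableSpace_of_chartedSpace {n : ℕ} (M : Type u) [TopologicalSpace M]
    [ChartedSpace (EuclideanSpace ℝ (Fin n)) M] [T2Space M] [CompactSpace M] :
    TopologicalSpace.MetrizableSpace M := by
  have := ChartedSpace.secondCountable_of_sigmaCompact (EuclideanSpace ℝ (Fin n)) M
  exact TopologicalSpace.metrizableSpace_of_t3_secondCountable M

end AbelianCover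

end

theorem mainTheorem6 {n b : ℕ} (hb : 0 < b)
    {M : Type u} [TopologicalSpace M] [ChartedSpace (EuclideanSpace ℝ (Fin n)) M]
    [IsManifold (𝓡 n) ∞ M] [T2Space M] [CompactSpace M] [ConnectedSpace M]
    {N : Type v} [TopologicalSpace N] (p : C(N, M))
    (hp : AbelianCover.IsUniversalAbelianCover p)
    (Γ : Module.Basis (Fin b) ℤ (AbelianCover.H1 M))
    (η : Fin b → AbelianCover.CovectorField n M) (hη : AbelianCover.IsDualFamily Γ η)
    (x₀ : N) :
    -- the expanding case
    (∀ (f : C(M, M)) (F : C(N, N)) (A : Matrix (Fin b) (Fin b) ℤ),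
      (∀ x, p (F x) = f (p x)) →
      A = AbelianCover.homologyMatrix Γ f →
      AbelianCover.IsExpandingMatrix A →
      ∃ (βt : C(N, Fin b → ℝ)) (β : C(M, AbelianCover.Torus b)),
        (∀ x, Filter.Tendsto
          (fun k : ℕ => ((AbelianCover.toRealMatrix A)⁻¹ ^ k) *ᵥ
            AbelianCover.abelJacobi p η x₀ (F^[k] x)) Filter.atTop (𝓝 (βt x))) ∧
        (∀ x i, β (p x) i = (βt x i : UnitAddCircle)) ∧
        (∀ y, β (f y) = AbelianCover.toralEndomorphism A (β y)) ∧
        List.TFAE [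
          Function.Injective β,
          AbelianCover.IsCoverExpanding p F,
          ∃ d : N → N → ℝ, AbelianCover.IsEquivariantMetric p d ∧
            AbelianCover.IsProperMetric d ∧ AbelianCover.NoShadowing d F,
          ∀ d : N → N → ℝ, AbelianCover.IsEquivariantMetric p d →
            AbelianCover.IsProperMetric d → AbelianCover.NoShadowing d F]) ∧
    -- the hyperbolic case
    (∀ (h : M ≃ₜ M) (H : N ≃ₜ N) (A : Matrix (Fin b) (Fin b) ℤ),
      (∀ x, p (H x) = h (p x)) →
      A = AbelianCover.homologyMatrix Γ (h : C(M, M)) →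
      AbelianCover.IsHyperbolicMatrix A →
      ∃ (βt : C(N, Fin b → ℝ)) (β : C(M, AbelianCover.Torus b)),
        (∀ x y, (∃ K : ℝ, ∀ i : ℤ,
          ‖AbelianCover.abelJacobi p η x₀ ((H ^ i) x) -
            ((AbelianCover.toRealMatrix A) ^ i) *ᵥ y‖ ≤ K) ↔ y = βt x) ∧
        (∀ x i, β (p x) i = (βt x i : UnitAddCircle)) ∧
        (∀ y, β (h y) = AbelianCover.toralEndomorphism A (β y)) ∧
        List.TFAE [
          Function.Injective β,
          AbelianCover.IsCoverHyperbolic p H,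
          ∃ d : N → N → ℝ, AbelianCover.IsEquivariantMetric p d ∧
            AbelianCover.IsProperMetric d ∧ AbelianCover.NoTwoSidedShadowing d H,
          ∀ d : N → N → ℝ, AbelianCover.IsEquivariantMetric p d →
            AbelianCover.IsProperMetric d → AbelianCover.NoTwoSidedShadowing d H]) := by
  obtain ⟨j, abelJacobi_eq, hj, map_sub_map⟩ := AbelianCover.exists_periodMap hp Γ hη x₀
  have isLocalHomeomorph_p := hp.covering.isLocalHomeomorph
  have := AbelianCover.metrizableSpace_of_chartedSpace (n := n) M
  simp only [abelJacobi_eq]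
  constructor
  · rintro f F A hF rfl hA
    exact hj.expanding isLocalHomeomorph_p hp.surjective hF (map_sub_map f F hF) hA
  · rintro h H A hH rfl hA
    exact hj.hyperbolic isLocalHomeomorph_p hp.surjective hH (map_sub_map h H hH)
      (AbelianCover.det_homologyMatrix_ne_zero Γ h) hA
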